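/- Fix a universe of sets, called small; categories may be large. A directed colimit is a colimit of a diagram indexed by a small nonempty directed poset. Let $\mathbf{Acc}$ be the 2-category of accessible categories, accessible functors and natural transformations. A pair $(\mathcal K,U)$ is an accessible category with concrete directed colimits if $\mathcal K$ is an accessible category with directed colimits and $U:\mathcal K\to\mathbf{Set}$ is a faithful functor preserving directed colimits. Let $\mathbf{Acc}_1$ be the 2-category whose objects are the accessible categories with directed colimits $\mathcal K$ for which such a $U$ exists, whose morphisms are the functors preserving directed colimits (not required to commute with the functors $U$), and whose 2-cells are all natural transformations. **Theorem.** $\mathbf{Acc}_1$ is a sub-2-category of $\mathbf{Acc}$, and it is closed in $\mathbf{Acc}$ under PIE-limits, that is, under products, inserters and equifiers (as strict 2-dimensional limits). Explicitly: 1. (Products) For every small family $(\mathcal K_i)_{i\in I}$ of objects of $\mathbf{Acc}_1$, the product category $\prod_{i\in I}\mathcal K_i$ with its projections is the product in $\mathbf{Acc}$. Every product of the family in $\mathbf{Acc}$ lies, with its projections, in $\mathbf{Acc}_1$ and is a product there. 2. (Inserters) Let $F,G:\mathcal K\to\mathcal L$ be morphisms of $\mathbf{Acc}_1$, and let $\mathrm{Ins}(F,G)$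 be the category whose objects are pairs $(K,\,f:FK\to GK)$ and whose morphisms $(K,f)\to(K',f')$ are the morphisms $k:K\to K'$ with $f'\circ Fk=Gk\circ f$. Then $\mathrm{Ins}(F,G)$, with the projection $P$ to $\mathcal K$ and the canonical natural transformation $FP\to GP$, is the inserter of $F$ and $G$ in $\mathbf{Acc}$. Every inserter of $F$ and $G$ in $\mathbf{Acc}$ lies, with its projection to $\mathcal K$, in $\mathbf{Acc}_1$ and is an inserter there. 3. (Equifiers) Let moreover $\varphi,\psi:F\to G$ be natural transformations. The full subcategory of $\mathcal K$ on the objects $K$ with $\varphi_K=\psi_K$, with its inclusion, is the equifier of $\varphi$ and $\psi$ in $\mathbf{Acc}$. Every equifier of $\varphi$ and $\psi$ in $\mathbf{Acc}$ lies, with its morphism to $\mathcal K$, in $\mathbf{Acc}_1$ and is an equifier there. Moreover, if $(\mathcal K_i,U_i)_{i\in I}$ is a small family of accessible categories with concrete directed colimits, then $\bigl(\prod_{i\in I}\mathcal K_i,\,U\bigr)$ is an accessible category with concrete directed colimits, where $U$ sends $(A_i)_{i\in I}$ to the disjoint union $\coprod_{i\in I}U_iA_i$. -/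

import Mathlib

open CategoryTheory CategoryTheory.Limits

universe w v₁ v₂ u₁ u₂

noncomputable section

namespace AccPIE

/-! ### Directed colimits -/

section Directed

variable (C : Type u₁) [Category.{v₁} C]

/-- `C` has (small) directed colimits: colimits of all diagrams indexed by small nonempty
directed posets. -/
def HasDirectedColimits : Prop :=
  ∀ (J : Type w) [PartialOrder J] [IsDirectedOrder J] [Nonempty J], HasColimitsOfShape J C

variable {C} {D : Type u₂} [Category.{v₂} D]

/-- `F` preserves (small) directed colimits. -/
def PreservesDirectedColimits (F : C ⥤ D) : Prop :=
  ∀ (J : Type w) [PartialOrder J] [IsDirectedOrder J] [Nonempty J], PreservesColimitsOfShape J F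

end Directed

/-- `(K, U)` is an accessible category with concrete directed colimits: `K` is an accessible
category with directed colimits and `U : K ⥤ Set` is faithful and preserves directed colimits. -/
structure IsAccessibleWithConcreteDirectedColimits (K : Type (w + 1)) [Category.{w} K]
    (U : K ⥤ Type w) : Prop where
  accessible : IsAccessibleCategory.{w} K
  hasDirectedColimits : HasDirectedColimits.{w} K
  faithful : U.Faithful
  preserves : PreservesDirectedColimits.{w} U

/-! ### Inserter and equifier categories, disjoint unions of set-valued functors -/

section Constructions

variable {K : Type u₁} [Category.{v₁} K] {L : Type u₂} [Category.{v₂} L]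

/-- Objects of the inserter category of `F` and `G`: an object `pt` of `K` with a morphism
`F pt ⟶ G pt`. -/
structure Ins (F G : K ⥤ L) where
  pt : K
  str : F.obj pt ⟶ G.obj pt

namespace Ins

variable {F G : K ⥤ L}

/-- Morphisms of the inserter category: morphisms of `K` compatible with the structure
morphisms. -/
@[ext]
structure Hom (A B : Ins F G) where
  hom : A.pt ⟶ B.pt
  w : F.map hom ≫ B.str = A.str ≫ G.map hom

instance : Category (Ins F G) where
  Hom := Hom
  id A := { hom := 𝟙 A.pt, w := by simp }
  comp f g :=
    { hom := f.hom ≫ g.hom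
      w := by rw [F.map_comp, G.map_comp, Category.assoc, g.w, ← Category.assoc, f.w,
        Category.assoc] }
  id_comp _ := Hom.ext (Category.id_comp _)
  comp_id _ := Hom.ext (Category.comp_id _)
  assoc _ _ _ := Hom.ext (Category.assoc _ _ _)

variable (F G)

/-- The projection functor from the inserter category. -/
def proj : Ins F G ⥤ K where
  obj A := A.pt
  map f := f.hom

/-- The canonical natural transformation `F P ⟶ G P` on the inserter category. -/
def nat : proj F G ⋙ F ⟶ proj F G ⋙ G where
  app A := A.str
  naturality _ _ f := f.w

end Ins

/-- The property of an object that the components of `φ` and `ψ` at it are equal. -/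
def eqProp {F G : K ⥤ L} (φ ψ : F ⟶ G) : ObjectProperty K := fun A => φ.app A = ψ.app A

/-- The equifier category of `φ` and `ψ`, a full subcategory of `K`. -/
abbrev Eqf {F G : K ⥤ L} (φ ψ : F ⟶ G) := (eqProp φ ψ).FullSubcategory

end Constructions

/-- The functor sending a family `(A i)` to the disjoint union of the sets `U i (A i)`. -/
def disjointUnion {I : Type w} {K : I → Type (w + 1)} [∀ i, Category.{w} (K i)]
    (U : ∀ i, K i ⥤ Type w) : (∀ i, K i) ⥤ Type w where
  obj A := Σ i, (U i).obj (A i)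
  map f := ↾fun x => ⟨x.1, (U x.1).map (f x.1) x.2⟩

/-- A functor is an isomorphism of categories if it is fully faithful and bijective on objects. -/
structure IsIsoOfCategories {A : Type u₁} [Category.{v₁} A] {B : Type u₂} [Category.{v₂} B]
    (T : A ⥤ B) : Prop where
  full : T.Full
  faithful : T.Faithful
  bijective_obj : Function.Bijective T.obj

/-! ### Sub-2-categories of the 2-category of categories -/

/-- A sub-2-category, full on 2-cells, of the 2-category of (locally small, possibly large)
categories, functors and natural transformations: a class of categories and a class of functors
that contains the identities and is closed under composition. -/
structure SubTwoCat where
  Obj : ∀ (C : Type (w + 1)) [Category.{w} C], Prop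
  Mor : ∀ {C D : Type (w + 1)} [Category.{w} C] [Category.{w} D], (C ⥤ D) → Prop
  id_mem : ∀ (C : Type (w + 1)) [Category.{w} C], Mor (𝟭 C)
  comp_mem : ∀ {C D E : Type (w + 1)} [Category.{w} C] [Category.{w} D] [Category.{w} E]
    {F : C ⥤ D} {G : D ⥤ E}, Mor F → Mor G → Mor (F ⋙ G)

namespace SubTwoCat

/-- `𝒮` is contained in `𝒯`: the objects of `𝒮` are objects of `𝒯`, and the morphisms of `𝒮`
between objects of `𝒮` are morphisms of `𝒯`. -/
structure IsContainedIn (𝒮 𝒯 : SubTwoCat.{w}) : Prop where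
  obj : ∀ (C : Type (w + 1)) [Category.{w} C], 𝒮.Obj C → 𝒯.Obj C
  mor : ∀ {C D : Type (w + 1)} [Category.{w} C] [Category.{w} D] (F : C ⥤ D),
    𝒮.Obj C → 𝒮.Obj D → 𝒮.Mor F → 𝒯.Mor F

/-- The full sub-2-category of `𝒮` on the objects satisfying `P`. -/
def fullSub (𝒮 : SubTwoCat.{w}) (P : ∀ (C : Type (w + 1)) [Category.{w} C], Prop) :
    SubTwoCat.{w} where
  Obj C := 𝒮.Obj C ∧ P C
  Mor F := 𝒮.Mor F
  id_mem := 𝒮.id_mem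
  comp_mem := 𝒮.comp_mem

section Limits

variable (𝒮 : SubTwoCat.{w})

/-- The category of morphisms of `𝒮` from `X` to `K` and all natural transformations
between them. -/
abbrev HomCat (X K : Type (w + 1)) [Category.{w} X] [Category.{w} K] :=
  ObjectProperty.FullSubcategory (fun F : X ⥤ K => 𝒮.Mor F)

variable {K L E : Type (w + 1)} [Category.{w} K] [Category.{w} L] [Category.{w} E]
variable (X : Type (w + 1)) [Category.{w} X]

/-- Composition with `F : K ⥤ L`, as a functor `𝒮(X, K) ⥤ 𝒮(X, L)`. -/
def postcomp {F : K ⥤ L} (hF : 𝒮.Mor F) : 𝒮.HomCat X K ⥤ 𝒮.HomCat X L :=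
  ObjectProperty.lift _ (ObjectProperty.ι _ ⋙ (Functor.whiskeringRight X K L).obj F)
    (fun H => 𝒮.comp_mem H.property hF)

/-- Whiskering with `φ : F ⟶ G`, as a natural transformation between functors
`𝒮(X, K) ⥤ 𝒮(X, L)`. -/
def postcompNat {F G : K ⥤ L} (hF : 𝒮.Mor F) (hG : 𝒮.Mor G) (φ : F ⟶ G) :
    𝒮.postcomp X hF ⟶ 𝒮.postcomp X hG where
  app H := ObjectProperty.homMk (Functor.whiskerLeft H.obj φ)
  naturality _ _ τ := by
    apply ObjectProperty.hom_ext
    ext A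
    exact φ.naturality (τ.hom.app A)

/-- The comparison functor `H ↦ (H ⋙ P i)` from `𝒮(X, E)` to `∏ 𝒮(X, K i)`. -/
def productComparison {I : Type w} {K : I → Type (w + 1)} [∀ i, Category.{w} (K i)]
    {P : ∀ i, E ⥤ K i} (hP : ∀ i, 𝒮.Mor (P i)) :
    𝒮.HomCat X E ⥤ (∀ i, 𝒮.HomCat X (K i)) :=
  Functor.pi' (fun i => 𝒮.postcomp X (hP i))

/-- The comparison functor `H ↦ (H ⋙ P, H ◁ φ)` from `𝒮(X, E)` to the inserter category of the
two functors `𝒮(X, K) ⥤ 𝒮(X, L)` given by composition with `F` and `G`. -/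
def inserterComparison {F G : K ⥤ L} (hF : 𝒮.Mor F) (hG : 𝒮.Mor G) {P : E ⥤ K} (hP : 𝒮.Mor P)
    (φ : P ⋙ F ⟶ P ⋙ G) :
    𝒮.HomCat X E ⥤ Ins (𝒮.postcomp X hF) (𝒮.postcomp X hG) where
  obj H :=
    { pt := (𝒮.postcomp X hP).obj H
      str := ObjectProperty.homMk (Functor.whiskerLeft H.obj φ) }
  map τ :=
    { hom := (𝒮.postcomp X hP).map τ
      w := by
        apply ObjectProperty.hom_ext
        ext A
        exact φ.naturality (τ.hom.app A) }
  map_id H := Ins.Hom.ext ((𝒮.postcomp X hP).map_id H)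
  map_comp τ τ' := Ins.Hom.ext ((𝒮.postcomp X hP).map_comp τ τ')

/-- The comparison functor `H ↦ H ⋙ P` from `𝒮(X, E)` to the equifier category of the two natural
transformations between functors `𝒮(X, K) ⥤ 𝒮(X, L)` given by whiskering with `φ` and `ψ`. -/
def equifierComparison {F G : K ⥤ L} (hF : 𝒮.Mor F) (hG : 𝒮.Mor G) (φ ψ : F ⟶ G)
    {P : E ⥤ K} (hP : 𝒮.Mor P)
    (h : Functor.whiskerLeft P φ = Functor.whiskerLeft P ψ) :
    𝒮.HomCat X E ⥤ Eqf (𝒮.postcompNat X hF hG φ) (𝒮.postcompNat X hF hG ψ) :=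
  ObjectProperty.lift _ (𝒮.postcomp X hP) (fun H => by
    apply ObjectProperty.hom_ext
    ext A
    exact NatTrans.congr_app h (H.obj.obj A))

/-- `E` with the projections `P i` is the (strict, 2-dimensional) product of the `K i` in `𝒮`. -/
structure IsProduct {I : Type w} (K : I → Type (w + 1)) [∀ i, Category.{w} (K i)]
    (E : Type (w + 1)) [Category.{w} E] (P : ∀ i, E ⥤ K i) : Prop where
  obj : 𝒮.Obj E
  mor : ∀ i, 𝒮.Mor (P i)
  universal : ∀ (X : Type (w + 1)) [Category.{w} X], 𝒮.Obj X →
    IsIsoOfCategories (𝒮.productComparison X mor)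

/-- `E` with `P : E ⥤ K` and `φ : P ⋙ F ⟶ P ⋙ G` is the (strict, 2-dimensional) inserter of the
morphisms `F` and `G` in `𝒮`. -/
structure IsInserter {F G : K ⥤ L} (hF : 𝒮.Mor F) (hG : 𝒮.Mor G)
    (E : Type (w + 1)) [Category.{w} E] (P : E ⥤ K) (φ : P ⋙ F ⟶ P ⋙ G) : Prop where
  obj : 𝒮.Obj E
  mor : 𝒮.Mor P
  universal : ∀ (X : Type (w + 1)) [Category.{w} X], 𝒮.Obj X →
    IsIsoOfCategories (𝒮.inserterComparison X hF hG mor φ)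

/-- `E` with `P : E ⥤ K` is the (strict, 2-dimensional) equifier of the 2-cells `φ` and `ψ`
between the morphisms `F` and `G` in `𝒮`. -/
structure IsEquifier {F G : K ⥤ L} (hF : 𝒮.Mor F) (hG : 𝒮.Mor G) (φ ψ : F ⟶ G)
    (E : Type (w + 1)) [Category.{w} E] (P : E ⥤ K) : Prop where
  obj : 𝒮.Obj E
  mor : 𝒮.Mor P
  eq : Functor.whiskerLeft P φ = Functor.whiskerLeft P ψ
  universal : ∀ (X : Type (w + 1)) [Category.{w} X], 𝒮.Obj X →
    IsIsoOfCategories (𝒮.equifierComparison X hF hG φ ψ mor eq)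

end Limits

/-- `𝒮` is closed under products in `𝒯`: for every small family of objects of `𝒮`, the product
category with its projections is the product in `𝒯`, and every product in `𝒯` of the family
lies in `𝒮` and is a product there. -/
def ClosedUnderProductsIn (𝒮 𝒯 : SubTwoCat.{w}) : Prop :=
  ∀ (I : Type w) (K : I → Type (w + 1)) [∀ i, Category.{w} (K i)], (∀ i, 𝒮.Obj (K i)) →
    𝒯.IsProduct K (∀ i, K i) (Pi.eval K) ∧
    ∀ (E : Type (w + 1)) [Category.{w} E] (P : ∀ i, E ⥤ K i),
      𝒯.IsProduct K E P → 𝒮.IsProduct K E P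

/-- `𝒮` is closed under inserters in `𝒯`: for every parallel pair of morphisms of `𝒮`, the
inserter category with its canonical data is the inserter in `𝒯`, and every inserter in `𝒯` of
the pair lies in `𝒮` and is an inserter there. -/
def ClosedUnderInsertersIn (𝒮 𝒯 : SubTwoCat.{w}) : Prop :=
  ∀ (K L : Type (w + 1)) [Category.{w} K] [Category.{w} L] (F G : K ⥤ L),
    𝒮.Obj K → 𝒮.Obj L → ∀ (hF : 𝒮.Mor F) (hG : 𝒮.Mor G),
    ∃ (hF' : 𝒯.Mor F) (hG' : 𝒯.Mor G),
      𝒯.IsInserter hF' hG' (Ins F G) (Ins.proj F G) (Ins.nat F G) ∧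
      ∀ (E : Type (w + 1)) [Category.{w} E] (P : E ⥤ K) (φ : P ⋙ F ⟶ P ⋙ G),
        𝒯.IsInserter hF' hG' E P φ → 𝒮.IsInserter hF hG E P φ

/-- `𝒮` is closed under equifiers in `𝒯`: for every parallel pair of 2-cells of `𝒮`, the
equifier category with its inclusion is the equifier in `𝒯`, and every equifier in `𝒯` of the
pair lies in `𝒮` and is an equifier there. -/
def ClosedUnderEquifiersIn (𝒮 𝒯 : SubTwoCat.{w}) : Prop :=
  ∀ (K L : Type (w + 1)) [Category.{w} K] [Category.{w} L] (F G : K ⥤ L),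
    𝒮.Obj K → 𝒮.Obj L → ∀ (hF : 𝒮.Mor F) (hG : 𝒮.Mor G) (φ ψ : F ⟶ G),
    ∃ (hF' : 𝒯.Mor F) (hG' : 𝒯.Mor G),
      𝒯.IsEquifier hF' hG' φ ψ (Eqf φ ψ) (eqProp φ ψ).ι ∧
      ∀ (E : Type (w + 1)) [Category.{w} E] (P : E ⥤ K),
        𝒯.IsEquifier hF' hG' φ ψ E P → 𝒮.IsEquifier hF hG φ ψ E P

/-- `𝒮` is a sub-2-category of `𝒯` closed under products, inserters and equifiers in `𝒯`. -/
structure ClosedUnderPIELimitsIn (𝒮 𝒯 : SubTwoCat.{w}) : Prop where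
  contained : 𝒮.IsContainedIn 𝒯
  products : 𝒮.ClosedUnderProductsIn 𝒯
  inserters : 𝒮.ClosedUnderInsertersIn 𝒯
  equifiers : 𝒮.ClosedUnderEquifiersIn 𝒯

end SubTwoCat

/-- The 2-category of accessible categories, accessible functors and natural transformations. -/
def Acc : SubTwoCat.{w} where
  Obj C := IsAccessibleCategory.{w} C
  Mor F := F.IsAccessible.{w}
  id_mem C :=
    haveI : Fact Cardinal.aleph0.{w}.IsRegular := Cardinal.fact_isRegular_aleph0
    Functor.isAccessible_of_isCardinalAccessible (𝟭 C) Cardinal.aleph0.{w}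
  comp_mem {_ _ _} _ _ _ F G hF hG :=
    haveI := hF
    haveI := hG
    (inferInstance : (F ⋙ G).IsAccessible)

/-- The 2-category of accessible categories with directed colimits, functors preserving directed
colimits and natural transformations. -/
def AccZero : SubTwoCat.{w} where
  Obj C := IsAccessibleCategory.{w} C ∧ HasDirectedColimits.{w} C
  Mor F := PreservesDirectedColimits.{w} F
  id_mem _ := fun _ _ _ _ => inferInstance
  comp_mem {_ _ _} _ _ _ F G hF hG := fun J _ _ _ =>
    haveI := hF J
    haveI := hG J
    (inferInstance : PreservesColimitsOfShape J (F ⋙ G))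

/-- The full sub-2-category of `AccZero` consisting of the accessible categories with concrete
directed colimits. -/
def AccOne : SubTwoCat.{w} :=
  AccZero.fullSub (fun C _ => ∃ U : C ⥤ Type w, IsAccessibleWithConcreteDirectedColimits C U)

end AccPIE

end

universe v₃ u₃

namespace AccPIE

/-! ### Directed and filtered colimits -/

section Directed

variable {C : Type u₁} [Category.{v₁} C] {D : Type u₂} [Category.{v₂} D]

/-! The canonical product, inserter and equifier categories inherit directed colimits from their
components, and the projections detect them. A faithful functor to sets is obtained on a product
from the disjoint union, and on an inserter or equifier by composing the projection with the one on
`K`. The substance is accessibility.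

Two facts on an accessible category `K` with directed colimits are used throughout. First, `K` is
`μ`-accessible for every large enough regular `μ`: a directed colimit is the `μ`-filtered colimit of
the colimits over its directed subsets of cardinality `< μ`, and these partial colimits are
`μ`-presentable (`partialColimits.isColimit_cocone`,
`HasDirectedColimits.isCardinalAccessibleCategory_of_le`). Second, a functor `F` preserving directed
colimits preserves `μ`-presentable objects for suitable uncountable `μ`
(`PreservesDirectedColimits.exists_cardinal`). For a product, one `μ` above all the indices and
above the size of `I` suffices.

For an inserter, write `X` as the canonical `μ`-filtered colimit of `μ`-presentable objects. As `μ`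
is uncountable, this diagram is closed under colimits of sequences. A structure morphism `f : F X ⟶
G X` restricts to morphisms from `F` of one stage to `G` of a later stage; iterating `ω` times and
taking the colimit, which `F` preserves, gives a `μ`-presentable object carrying its own structure
morphism (`Ins.exists_approximation`). Such approximations are cofinal in the diagram, so `(X, f)`
is a `μ`-filtered colimit of them. Equifiers use the same iteration (`Eqf.exists_hom_eqProp`).

Finally, strict limits are unique up to isomorphism, so any limit in `Acc` may be compared with the
canonical one. Its universal property restricts to `AccOne` because 2-cells are the same and a
functor into it preserves directed colimits as soon as its composites with the projections do. -/

lemma HasDirectedColimits.hasColimitsOfShape (h : HasDirectedColimits.{w} C)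
    (J : Type w) [SmallCategory J] [IsFiltered J] : HasColimitsOfShape J C := by
  obtain ⟨α, _, _, _, F, _⟩ := IsFiltered.exists_directed J
  have := h α
  exact Functor.Final.hasColimitsOfShape_of_final F

lemma PreservesDirectedColimits.preservesColimitsOfShape {F : C ⥤ D}
    (h : PreservesDirectedColimits.{w} F)
    (J : Type w) [SmallCategory J] [IsFiltered J] : PreservesColimitsOfShape J F := by
  obtain ⟨α, _, _, _, G, _⟩ := IsFiltered.exists_directed J
  have := h α
  exact Functor.Final.preservesColimitsOfShape_of_final G F

lemma HasDirectedColimits.hasCardinalFilteredColimits (h : HasDirectedColimits.{w} C)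
    (κ : Cardinal.{w}) [Fact κ.IsRegular] : HasCardinalFilteredColimits C κ where
  hasColimitsOfShape J _ _ := by
    have := isFiltered_of_isCardinalFiltered J κ
    exact h.hasColimitsOfShape J

lemma PreservesDirectedColimits.isCardinalAccessible {F : C ⥤ D}
    (h : PreservesDirectedColimits.{w} F) (κ : Cardinal.{w}) [Fact κ.IsRegular] :
    F.IsCardinalAccessible κ where
  preservesColimitOfShape J _ _ := by
    have := isFiltered_of_isCardinalFiltered J κ
    exact h.preservesColimitsOfShape J

lemma PreservesDirectedColimits.isAccessible {F : C ⥤ D}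
    (h : PreservesDirectedColimits.{w} F) : F.IsAccessible.{w} :=
  haveI := Cardinal.fact_isRegular_aleph0.{w}
  haveI := h.isCardinalAccessible Cardinal.aleph0.{w}
  F.isAccessible_of_isCardinalAccessible Cardinal.aleph0.{w}

lemma HasDirectedColimits.hasColimitsOfShape_nat (h : HasDirectedColimits.{w} C) :
    HasColimitsOfShape ℕ C :=
  haveI := h (ULift.{w} ℕ)
  hasColimitsOfShape_of_equivalence (ULift.orderIso.{w} (α := ℕ)).equivalence

lemma PreservesDirectedColimits.preservesColimitsOfShape_nat {F : C ⥤ D}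
    (h : PreservesDirectedColimits.{w} F) : PreservesColimitsOfShape ℕ F :=
  haveI := h (ULift.{w} ℕ)
  preservesColimitsOfShape_of_equiv (ULift.orderIso.{w} (α := ℕ)).equivalence F

lemma HasDirectedColimits.of_equivalence (h : HasDirectedColimits.{w} C) (e : C ≌ D) :
    HasDirectedColimits.{w} D := fun J _ _ _ =>
  haveI := h J
  Adjunction.hasColimitsOfShape_of_equivalence e.inverse

lemma preservesDirectedColimits_of_isEquivalence (F : C ⥤ D) [F.IsEquivalence] :
    PreservesDirectedColimits.{w} F := fun _ _ _ _ => inferInstance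

end Directed

/-! ### Regular cardinals -/

lemma exists_regular_ge {ι : Type w} (κ : ι → Cardinal.{w}) :
    ∃ (μ : Cardinal.{w}) (_ : Fact μ.IsRegular), Cardinal.aleph0 < μ ∧ HasCardinalLT ι μ ∧
      ∀ i, κ i < μ := by
  -- The three kinds of summands force `κ i < μ`, `ℵ₀ < μ` and the bound on `ι`.
  obtain ⟨μ, hμ, h⟩ := HasCardinalLT.exists_regular_cardinal_forall.{w}
    (Sum.elim (fun i => (κ i).ord.ToType)
      (Sum.elim (fun _ : Unit => ULift.{w} ℕ) (fun _ : Unit => ι)))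
  refine ⟨μ, ⟨hμ⟩, ?_, h (Sum.inr (Sum.inr ⟨⟩)), fun i => ?_⟩
  · simpa [hasCardinalLT_iff_cardinal_mk_lt] using h (Sum.inr (Sum.inl ⟨⟩))
  · simpa [hasCardinalLT_iff_cardinal_mk_lt] using h (Sum.inl i)

/-! ### Small directed subsets of a directed poset -/

section DirectedSubset

lemma hasCardinalLT_finset {X : Type w} {μ : Cardinal.{w}} (hμ : Cardinal.aleph0 < μ)
    (hX : HasCardinalLT X μ) : HasCardinalLT (Finset X) μ := by
  cases finite_or_infinite X
  · exact hasCardinalLT_of_finite _ _ hμ.le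
  · rw [hasCardinalLT_iff_cardinal_mk_lt, Cardinal.mk_finset_of_infinite]
    simpa [hasCardinalLT_iff_cardinal_mk_lt] using hX

lemma hasCardinalLT_arrow_of_preorder {X : Type w} [Preorder X] {μ : Cardinal.{w}}
    (hμ : Cardinal.aleph0 ≤ μ) (hX : HasCardinalLT X μ) : HasCardinalLT (Arrow X) μ :=
  (hasCardinalLT_prod hμ hX hX).of_injective (fun f : Arrow X => (f.left, f.right)) (by
    rintro ⟨a, b, f⟩ ⟨a', b', f'⟩ h
    obtain ⟨rfl, rfl⟩ := Prod.mk.inj h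
    obtain rfl : f = f' := Subsingleton.elim _ _
    rfl)

variable (J : Type w) [PartialOrder J] (μ : Cardinal.{w})

/-- The poset of nonempty directed subsets of `J` of cardinality `< μ`. -/
abbrev DirectedSubset : Type w :=
  { S : Set J // IsDirectedOrder S ∧ S.Nonempty ∧ HasCardinalLT S μ }

variable {J μ}

/-- `ℵ₀` is sharply smaller than every uncountable regular `μ`, because a set with fewer than `μ`
elements has fewer than `μ` finite subsets. Hence a small subset can be enlarged to a small directed
one. -/
lemma DirectedSubset.exists_superset [IsDirectedOrder J] [Nonempty J] [Fact μ.IsRegular]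
    (hμ : Cardinal.aleph0 < μ) (A : Set J) (hA : HasCardinalLT A μ) :
    ∃ S : DirectedSubset J μ, A ⊆ S.1 := by
  have := Cardinal.fact_isRegular_aleph0.{w}
  have : IsCardinalFiltered J Cardinal.aleph0.{w} :=
    (isCardinalFiltered_aleph0_iff J).2 inferInstance
  obtain ⟨B, hAB, _, hB⟩ :=
    Cardinal.SharplyLT.exists_isCardinalFiltered_set_of_exists_cofinal hμ (fun X hX => by
      refine ⟨Set.univ, ?_, fun x => ⟨x, trivial, le_rfl⟩⟩
      refine (hasCardinalLT_finset hμ hX).of_surjective (fun s : Finset X =>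
        ⟨⟨(s : Set X), hasCardinalLT_of_finite _ _ le_rfl⟩, trivial⟩) ?_
      rintro ⟨⟨s, hs⟩, -⟩
      have : Finite s := (hasCardinalLT_aleph0_iff _).1 hs
      exact ⟨(Set.toFinite s).toFinset, by simp⟩) A hA
  have : IsFiltered B := isFiltered_of_isCardinalFiltered B Cardinal.aleph0.{w}
  obtain ⟨b⟩ := IsFiltered.nonempty (C := B)
  exact ⟨⟨B, IsFiltered.isDirectedOrder _, ⟨b, b.2⟩, hB⟩, hAB⟩

/-- By regularity, a union of fewer than `μ` small subsets is small; it need not be directed, but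
lies in a small directed subset. -/
lemma DirectedSubset.isCardinalFiltered [IsDirectedOrder J] [Nonempty J] [Fact μ.IsRegular]
    (hμ : Cardinal.aleph0 < μ) : IsCardinalFiltered (DirectedSubset J μ) μ :=
  isCardinalFiltered_preorder _ _ (fun ι S hι => by
    obtain ⟨T, hT⟩ := DirectedSubset.exists_superset (J := J) hμ (⋃ i, (S i).1)
      (hasCardinalLT_iUnion _ (by rwa [hasCardinalLT_iff_cardinal_mk_lt]) (fun i => (S i).2.2.2))
    exact ⟨T, fun i => (Set.subset_iUnion (fun i => (S i).1) i).trans hT⟩)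

variable {K : Type u₁} [Category.{v₁} K] (D : J ⥤ K)

/-- The restriction of a diagram to a directed subset. -/
abbrev DirectedSubset.restrict (S : DirectedSubset J μ) : S.1 ⥤ K :=
  (Subtype.mono_coe (fun x => x ∈ S.1)).functor ⋙ D

variable [∀ S : DirectedSubset J μ, HasColimitsOfShape S.1 K]

/-- The inclusion of an object of a diagram in a colimit over a directed subset. -/
noncomputable def partialColimits.ι (S : DirectedSubset J μ) (j : J) (hj : j ∈ S.1) :
    D.obj j ⟶ colimit (S.restrict D) :=
  colimit.ι (S.restrict D) ⟨j, hj⟩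

lemma partialColimits.w (S : DirectedSubset J μ) {i j : J} (f : i ⟶ j) (hi : i ∈ S.1)
    (hj : j ∈ S.1) :
    D.map f ≫ partialColimits.ι D S j hj = partialColimits.ι D S i hi :=
  colimit.w (S.restrict D) (homOfLE (leOfHom f) : (⟨i, hi⟩ : S.1) ⟶ ⟨j, hj⟩)

variable {D} in
lemma partialColimits.hom_ext {S : DirectedSubset J μ} {X : K}
    {f g : colimit (S.restrict D) ⟶ X}
    (h : ∀ j hj, partialColimits.ι D S j hj ≫ f = partialColimits.ι D S j hj ≫ g) : f = g :=
  colimit.hom_ext fun j => h j.1 j.2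

/-- The transition morphism between colimits over directed subsets. -/
noncomputable def partialColimits.transition {S T : DirectedSubset J μ} (h : S ≤ T) :
    colimit (S.restrict D) ⟶ colimit (T.restrict D) :=
  colimit.desc (S.restrict D)
    { pt := colimit (T.restrict D)
      ι :=
        { app j := partialColimits.ι D T j.1 (h j.2)
          naturality i j g :=
            (partialColimits.w D T (homOfLE (leOfHom g)) (h i.2) (h j.2)).trans
              (Category.comp_id _).symm } }

lemma partialColimits.ι_transition {S T : DirectedSubset J μ} (h : S ≤ T) (j : J)
    (hj : j ∈ S.1) :
    partialColimits.ι D S j hj ≫ partialColimits.transition D h =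
      partialColimits.ι D T j (h hj) :=
  colimit.ι_desc _ _

/-- The diagram of colimits of a given diagram over small directed subsets. -/
noncomputable def partialColimits : DirectedSubset J μ ⥤ K where
  obj S := colimit (S.restrict D)
  map f := partialColimits.transition D (leOfHom f)
  map_id S := partialColimits.hom_ext fun j hj =>
    (partialColimits.ι_transition D _ j hj).trans (Category.comp_id _).symm
  map_comp f g := partialColimits.hom_ext fun j hj => by
    rw [partialColimits.ι_transition, reassoc_of% @partialColimits.ι_transition,
      partialColimits.ι_transition]

/-- The morphism from a partial colimit to the point of a cocone. -/
noncomputable def partialColimits.desc (c : Cocone D) (S : DirectedSubset J μ) :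
    colimit (S.restrict D) ⟶ c.pt :=
  colimit.desc (S.restrict D) (c.whisker (Subtype.mono_coe (fun x => x ∈ S.1)).functor)

lemma partialColimits.ι_desc (c : Cocone D) (S : DirectedSubset J μ) (j : J) (hj : j ∈ S.1) :
    partialColimits.ι D S j hj ≫ partialColimits.desc D c S = c.ι.app j :=
  colimit.ι_desc _ _

lemma partialColimits.transition_desc (c : Cocone D) {S T : DirectedSubset J μ} (h : S ≤ T) :
    partialColimits.transition D h ≫ partialColimits.desc D c T =
      partialColimits.desc D c S :=
  partialColimits.hom_ext fun j hj => by
    rw [reassoc_of% @partialColimits.ι_transition, partialColimits.ι_desc, partialColimits.ι_desc]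

/-- The cocone over the diagram of partial colimits given by a cocone over the diagram. -/
noncomputable def partialColimits.cocone (c : Cocone D) :
    Cocone (partialColimits (μ := μ) D) where
  pt := c.pt
  ι :=
    { app S := partialColimits.desc D c S
      naturality _ _ f := (partialColimits.transition_desc D c (leOfHom f)).trans
        (Category.comp_id _).symm }

/-- A leg of a cocone over the diagram of partial colimits. -/
noncomputable def partialColimits.leg (s : Cocone (partialColimits (μ := μ) D))
    (S : DirectedSubset J μ) : colimit (S.restrict D) ⟶ s.pt :=
  s.ι.app S

lemma partialColimits.transition_leg (s : Cocone (partialColimits (μ := μ) D))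
    {S T : DirectedSubset J μ} (h : S ≤ T) :
    partialColimits.transition D h ≫ partialColimits.leg D s T = partialColimits.leg D s S :=
  s.w (homOfLE h)

variable [IsDirectedOrder J] [Nonempty J] [Fact μ.IsRegular]

/-- A colimit over a directed poset is the `μ`-filtered colimit of the colimits over the directed
subsets of cardinality `< μ`. -/
lemma partialColimits.isColimit_cocone (hμ : Cardinal.aleph0 < μ) {c : Cocone D}
    (hc : IsColimit c) :
    Nonempty (IsColimit (partialColimits.cocone (μ := μ) D c)) := by
  have := DirectedSubset.isCardinalFiltered (J := J) hμ
  have := isFiltered_of_isCardinalFiltered (DirectedSubset J μ) μ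
  have hmem (i j : J) : ∃ S : DirectedSubset J μ, i ∈ S.1 ∧ j ∈ S.1 := by
    obtain ⟨S, hS⟩ := DirectedSubset.exists_superset (μ := μ) hμ {i, j}
      (hasCardinalLT_of_finite _ _ hμ.le)
    exact ⟨S, hS (by simp), hS (by simp)⟩
  -- The restriction of a cocone to `D.obj j` does not depend on the directed subset containing `j`,
  -- since any two are contained in a third. This makes `t s` below a cocone over `D`.
  have hind (s : Cocone (partialColimits (μ := μ) D)) (S T : DirectedSubset J μ) (j : J)
      (hS : j ∈ S.1) (hT : j ∈ T.1) :
      partialColimits.ι D S j hS ≫ partialColimits.leg D s S =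
        partialColimits.ι D T j hT ≫ partialColimits.leg D s T := by
    rw [← partialColimits.transition_leg D s (leOfHom (IsFiltered.leftToMax S T)),
      ← partialColimits.transition_leg D s (leOfHom (IsFiltered.rightToMax S T)),
      reassoc_of% @partialColimits.ι_transition, reassoc_of% @partialColimits.ι_transition]
  choose S hS _ using fun j => hmem j j
  let t (s : Cocone (partialColimits (μ := μ) D)) : Cocone D :=
    { pt := s.pt
      ι :=
        { app j := partialColimits.ι D (S j) j (hS j) ≫ partialColimits.leg D s (S j)
          naturality i j f := by
            obtain ⟨T, hi, hj⟩ := hmem i j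
            rw [hind s _ T i _ hi, hind s _ T j _ hj, reassoc_of% @partialColimits.w]
            exact (Category.comp_id _).symm } }
  have hfac (s : Cocone (partialColimits (μ := μ) D)) (T : DirectedSubset J μ) :
      partialColimits.desc D c T ≫ hc.desc (t s) = partialColimits.leg D s T :=
    partialColimits.hom_ext fun j hj => by
      rw [reassoc_of% @partialColimits.ι_desc]
      exact (hc.fac (t s) j).trans (hind s _ _ _ _ _)
  have huniq (s : Cocone (partialColimits (μ := μ) D)) (m : c.pt ⟶ s.pt)
      (hm : ∀ T, partialColimits.desc D c T ≫ m = partialColimits.leg D s T) :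
      m = hc.desc (t s) :=
    hc.hom_ext fun j => by
      rw [hc.fac, ← partialColimits.ι_desc D c (S j) j (hS j), Category.assoc, hm]
  exact ⟨{ desc s := hc.desc (t s), fac := hfac, uniq := huniq }⟩

end DirectedSubset

/-! ### Raising the index of accessibility -/

section Raising

variable {K : Type u₁} [Category.{v₁} K]

/-- The property of being a directed colimit, over a poset of cardinality `< μ`, of objects
satisfying `P`. -/
def smallDirectedColimits (P : ObjectProperty K) (μ : Cardinal.{w}) : ObjectProperty K :=
  fun X => ∃ (S : Type w) (_ : PartialOrder S) (_ : IsDirectedOrder S) (_ : Nonempty S),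
    HasCardinalLT S μ ∧ P.colimitsOfShape S X

/-- Used twice: the closure under `μ`-small colimits consists of `μ`-presentable objects when `P`
does, and it is essentially small when `P` is. -/
lemma smallDirectedColimits_le_colimitsCardinalClosure (P : ObjectProperty K)
    {μ : Cardinal.{w}} (hμ : Cardinal.aleph0 ≤ μ) :
    smallDirectedColimits P μ ≤ P.colimitsCardinalClosure μ := by
  rintro X ⟨S, _, _, _, hS, ⟨p⟩⟩
  have := P.isClosedUnderColimitsOfShape_colimitsCardinalClosure μ S
    (hasCardinalLT_arrow_of_preorder hμ hS)
  exact (p.ofLE (P.le_colimitsCardinalClosure μ)).prop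

/-- Reindex by a directed poset, then group the diagram into its partial colimits. -/
lemma exists_colimitsOfShape_smallDirectedColimits (hK : HasDirectedColimits.{w} K)
    {P : ObjectProperty K} {μ : Cardinal.{w}} [Fact μ.IsRegular] (hμ : Cardinal.aleph0 < μ)
    {J : Type w} [SmallCategory J] [IsFiltered J] {X : K} (hX : P.colimitsOfShape J X) :
    ∃ (J' : Type w) (_ : SmallCategory J') (_ : IsCardinalFiltered J' μ),
      (smallDirectedColimits P μ).colimitsOfShape J' X := by
  obtain ⟨α, _, _, _, F, _⟩ := IsFiltered.exists_directed J
  obtain ⟨p⟩ := hX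
  let q := p.reindex F
  have (S : DirectedSubset α μ) : HasColimitsOfShape S.1 K :=
    haveI := S.2.1
    haveI := S.2.2.1.to_subtype
    hK S.1
  have hS (S : DirectedSubset α μ) :
      smallDirectedColimits P μ ((partialColimits q.diag).obj S) :=
    ⟨S.1, inferInstance, S.2.1, S.2.2.1.to_subtype, S.2.2.2,
      ⟨.colimit (S.restrict q.diag) (fun j => q.prop_diag_obj j.1)⟩⟩
  obtain ⟨hc⟩ := partialColimits.isColimit_cocone q.diag hμ q.isColimit
  exact ⟨DirectedSubset α μ, inferInstance, DirectedSubset.isCardinalFiltered hμ,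
    ⟨{ diag := partialColimits q.diag
       ι := _
       isColimit := hc
       prop_diag_obj := hS }⟩⟩

variable [LocallySmall.{w} K]

lemma smallDirectedColimits_isCardinalFilteredGenerator (hK : HasDirectedColimits.{w} K)
    {P : ObjectProperty K} {κ μ : Cardinal.{w}} [Fact κ.IsRegular] [Fact μ.IsRegular]
    (hκ : κ < μ) (hP : P.IsCardinalFilteredGenerator κ) :
    (smallDirectedColimits P μ).IsCardinalFilteredGenerator μ where
  le_isCardinalPresentable :=
    (smallDirectedColimits_le_colimitsCardinalClosure P
      (Cardinal.IsRegular.aleph0_le Fact.out)).trans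
      (P.colimitsCardinalClosure_le_isCardinalPresentable
        (hP.le_isCardinalPresentable.trans (isCardinalPresentable_monotone K hκ.le)))
  exists_colimitsOfShape X := by
    obtain ⟨J, _, _, hX⟩ := hP.exists_colimitsOfShape X
    have := isFiltered_of_isCardinalFiltered J κ
    exact exists_colimitsOfShape_smallDirectedColimits hK
      ((Cardinal.IsRegular.aleph0_le Fact.out).trans_lt hκ) hX

omit [LocallySmall.{w} K] in
/-- An accessible category with directed colimits is `μ`-accessible for all large enough regular
cardinals `μ`. -/
lemma HasDirectedColimits.isCardinalAccessibleCategory_of_le (hK : HasDirectedColimits.{w} K)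
    {κ μ : Cardinal.{w}} [Fact κ.IsRegular] [Fact μ.IsRegular] (hκ : κ ≤ μ)
    [IsCardinalAccessibleCategory K κ] : IsCardinalAccessibleCategory K μ := by
  obtain rfl | hκ := hκ.eq_or_lt
  · infer_instance
  obtain ⟨P, _, hP⟩ := HasCardinalFilteredGenerator.exists_generator K κ
  have hQ := smallDirectedColimits_isCardinalFilteredGenerator hK hκ hP
  have : ObjectProperty.EssentiallySmall.{w} (smallDirectedColimits P μ) :=
    .of_le (smallDirectedColimits_le_colimitsCardinalClosure P
      (Cardinal.IsRegular.aleph0_le Fact.out))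
  have := hQ.hasCardinalFilteredGenerator
  have := hK.hasCardinalFilteredColimits μ
  constructor

/-- A functor preserving directed colimits preserves `μ`-presentable objects as soon as it sends
the `κ`-presentable objects to `μ`-presentable objects for some smaller `κ`. -/
lemma PreservesDirectedColimits.isCardinalPresentable_obj {L : Type u₂} [Category.{v₂} L]
    [LocallySmall.{w} L] {F : K ⥤ L} (hF : PreservesDirectedColimits.{w} F)
    (hK : HasDirectedColimits.{w} K) {P : ObjectProperty K} {κ μ : Cardinal.{w}}
    [Fact κ.IsRegular] [Fact μ.IsRegular] (hκ : κ < μ) (hP : P.IsCardinalFilteredGenerator κ)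
    (h : ∀ A, P A → IsCardinalPresentable (F.obj A) μ) (A : K) [IsCardinalPresentable A μ] :
    IsCardinalPresentable (F.obj A) μ := by
  have hA : isCardinalPresentable K μ A := inferInstanceAs (IsCardinalPresentable A μ)
  -- So `A` is a retract of a `μ`-small directed colimit of objects of `P`. `F` preserves this
  -- colimit and the retraction, and `μ`-presentable objects are stable under both operations.
  rw [(smallDirectedColimits_isCardinalFilteredGenerator hK hκ hP).isPresentable_eq_retractClosure]
    at hA
  obtain ⟨B, ⟨S, _, _, _, hS, ⟨p⟩⟩, ⟨r⟩⟩ := hA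
  have := hF S
  have (j : S) : IsCardinalPresentable ((p.diag ⋙ F).obj j) μ := h _ (p.prop_diag_obj j)
  have : IsCardinalPresentable (F.obj B) μ :=
    isCardinalPresentable_of_isColimit _ (isColimitOfPreserves F p.isColimit) μ
      (hasCardinalLT_arrow_of_preorder (Cardinal.IsRegular.aleph0_le Fact.out) hS)
  exact (r.map F).isCardinalPresentable μ

end Raising

/-! ### Products of accessible categories -/

section Products

variable {I : Type w} {K : I → Type u₁} [∀ i, Category.{w} (K i)]

section Colimits

variable {J : Type w} [SmallCategory J]

lemma nonempty_isColimit_of_eval {D : J ⥤ ∀ i, K i} {c : Cocone D}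
    (h : ∀ i, Nonempty (IsColimit ((Pi.eval K i).mapCocone c))) : Nonempty (IsColimit c) :=
  ⟨pi.coconeOfCoconeEvalIsColimit (c := fun i => (Pi.eval K i).mapCocone c)
    (fun i => (h i).some)⟩

lemma preservesColimitsOfShape_of_comp_eval {X : Type u₂} [Category.{v₂} X]
    (H : X ⥤ ∀ i, K i) [∀ i, PreservesColimitsOfShape J (H ⋙ Pi.eval K i)] :
    PreservesColimitsOfShape J H where
  preservesColimit :=
    { preserves hc := nonempty_isColimit_of_eval fun i =>
        ⟨isColimitOfPreserves (H ⋙ Pi.eval K i) hc⟩ }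

lemma preservesDirectedColimits_of_comp_eval {X : Type u₂} [Category.{v₂} X]
    (H : X ⥤ ∀ i, K i) (h : ∀ i, PreservesDirectedColimits.{w} (H ⋙ Pi.eval K i)) :
    PreservesDirectedColimits.{w} H := fun J _ _ _ =>
  haveI := fun i => h i J
  preservesColimitsOfShape_of_comp_eval H

variable [∀ i, HasColimitsOfShape J (K i)]

lemma hasColimitsOfShape_pi : HasColimitsOfShape J (∀ i, K i) where
  has_colimit _ := pi.hasColimit_of_hasColimit_comp_eval

lemma preservesColimitsOfShape_eval (i : I) : PreservesColimitsOfShape J (Pi.eval K i) where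
  preservesColimit {D} :=
    preservesColimit_of_preserves_colimit_cocone
      (pi.coconeOfCoconeEvalIsColimit fun i => colimit.isColimit (D ⋙ Pi.eval K i))
      (colimit.isColimit (D ⋙ Pi.eval K i))

end Colimits

lemma hasDirectedColimits_pi (h : ∀ i, HasDirectedColimits.{w} (K i)) :
    HasDirectedColimits.{w} (∀ i, K i) := fun J _ _ _ =>
  haveI := fun i => h i J
  hasColimitsOfShape_pi

lemma preservesDirectedColimits_eval (h : ∀ i, HasDirectedColimits.{w} (K i)) (i : I) :
    PreservesDirectedColimits.{w} (Pi.eval K i) := fun J _ _ _ =>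
  haveI := fun i => h i J
  preservesColimitsOfShape_eval i

variable (μ : Cardinal.{w}) [Fact μ.IsRegular]

/-- Colimits are computed coordinatewise, and as `I` has fewer than `μ` elements, the stages found
in the coordinates have a common upper bound in a `μ`-filtered category. -/
lemma isCardinalPresentable_pi [∀ i, HasCardinalFilteredColimits (K i) μ]
    (hI : HasCardinalLT I μ) (A : ∀ i, K i) [∀ i, IsCardinalPresentable (A i) μ] :
    IsCardinalPresentable A μ where
  preservesColimitOfShape J _ _ := ⟨fun {D} => ⟨fun {c} hc => ⟨by
    have := fun i => HasCardinalFilteredColimits.hasColimitsOfShape (K i) μ J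
    have := fun i => preservesColimitsOfShape_eval (K := K) (J := J) i
    have := isFiltered_of_isCardinalFiltered J μ
    have := essentiallySmallSelf J
    have hc' (i : I) := isColimitOfPreserves (Pi.eval K i) hc
    refine Types.FilteredColimit.isColimitOf' _ _ (fun f => ?_) (fun j f g h => ?_)
    · choose j f' hf' using fun i =>
        IsCardinalPresentable.exists_hom_of_isColimit μ (hc' i) (X := A i) (f i)
      refine ⟨IsCardinalFiltered.max j hI,
        fun i => f' i ≫ D.map (IsCardinalFiltered.toMax j hI i) i, ?_⟩
      funext i
      refine (hf' i).symm.trans ?_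
      refine Eq.trans ?_ (Category.assoc _ _ _).symm
      exact congrArg (f' i ≫ ·) (congr_fun (c.w (IsCardinalFiltered.toMax j hI i)) i).symm
    · choose k a ha using fun i =>
        IsCardinalPresentable.exists_eq_of_isColimit' μ (hc' i) (X := A i) (f i) (g i)
          (congr_fun h i)
      obtain ⟨m, b, e, hb⟩ := IsCardinalFiltered.wideSpan a hI
      refine ⟨m, e, ?_⟩
      funext i
      have hi : f i ≫ D.map (a i) i = g i ≫ D.map (a i) i := ha i
      change f i ≫ D.map e i = g i ≫ D.map e i
      rw [← hb i, D.map_comp, Pi.comp_apply, reassoc_of% hi]⟩⟩⟩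

lemma isCardinalAccessibleCategory_pi [∀ i, IsCardinalAccessibleCategory (K i) μ]
    (hI : HasCardinalLT I μ) : IsCardinalAccessibleCategory (∀ i, K i) μ := by
  choose P hPs hP using fun i => HasCardinalFilteredGenerator.exists_small_generator (K i) μ
  let Q : ObjectProperty (∀ i, K i) := fun A => ∀ i, P i (A i)
  have : ObjectProperty.Small.{w} Q :=
    small_of_injective (f := fun (A : Subtype Q) i => (⟨A.1 i, A.2 i⟩ : Subtype (P i)))
      (fun A B h => Subtype.ext (funext fun i => congrArg Subtype.val (congr_fun h i)))
  have hQ : Q.IsCardinalFilteredGenerator μ :=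
    { le_isCardinalPresentable := fun A hA =>
        haveI := fun i => (hP i).le_isCardinalPresentable _ (hA i)
        haveI : ∀ i, IsCardinalPresentable (A i) μ := this
        isCardinalPresentable_pi μ hI A
      exists_colimitsOfShape := fun X => by
        choose J _ _ hJ using fun i => (hP i).exists_colimitsOfShape (X i)
        have := fun i => isFiltered_of_isCardinalFiltered (J i) μ
        let p (i : I) := (hJ i).some
        let c : Cocone (Functor.pi fun i => (p i).diag) :=
          { pt := X
            ι :=
              { app j i := (p i).ι.app (j i)
                naturality j j' f := funext fun i => (p i).ι.naturality (f i) } }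
        -- In coordinate `i`, the cocone over `∀ i, J i` is the reindexing of `p i` along the
        -- projection to `J i`, which is final.
        have hc : Nonempty (IsColimit c) := nonempty_isColimit_of_eval fun i =>
          ⟨(Functor.Final.isColimitWhiskerEquiv (Pi.eval J i) _).symm (p i).isColimit⟩
        exact ⟨∀ i, J i, inferInstance, inferInstance,
          ⟨{ diag := _
             ι := c.ι
             isColimit := hc.some
             prop_diag_obj := fun j i => (p i).prop_diag_obj (j i) }⟩⟩ }
  have := hQ.hasCardinalFilteredGenerator
  have : HasCardinalFilteredColimits (∀ i, K i) μ :=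
    ⟨fun J _ _ =>
      haveI := fun i => HasCardinalFilteredColimits.hasColimitsOfShape (K i) μ J
      hasColimitsOfShape_pi⟩
  constructor

/-- Directed colimits allow all the factors to be raised to one common index of accessibility. -/
lemma isAccessibleCategory_pi [h : ∀ i, IsAccessibleCategory.{w} (K i)]
    (hK : ∀ i, HasDirectedColimits.{w} (K i)) : IsAccessibleCategory.{w} (∀ i, K i) := by
  choose κ hκ _ using fun i => (h i).exists_cardinal
  obtain ⟨μ, _, -, hI, hμ⟩ := exists_regular_ge κ
  have := fun i => (hK i).isCardinalAccessibleCategory_of_le (hμ i).le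
  exact ⟨μ, inferInstance, isCardinalAccessibleCategory_pi μ hI⟩

lemma isAccessible_of_comp_eval {X : Type u₂} [Category.{v₂} X]
    (H : X ⥤ ∀ i, K i) [h : ∀ i, (H ⋙ Pi.eval K i).IsAccessible.{w}] :
    H.IsAccessible.{w} := by
  choose κ hκ _ using fun i => (h i).exists_cardinal
  obtain ⟨μ, _, -, -, hμ⟩ := exists_regular_ge κ
  have := fun i => (H ⋙ Pi.eval K i).isCardinalAccessible_of_le (hμ i).le
  exact ⟨μ, inferInstance, ⟨fun J _ _ =>
    haveI := fun i =>
      (H ⋙ Pi.eval K i).preservesColimitsOfShape_of_isCardinalAccessible μ J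
    preservesColimitsOfShape_of_comp_eval H⟩⟩

end Products

/-! ### Disjoint unions of set-valued functors -/

section DisjointUnion

variable {I : Type w} {K : I → Type (w + 1)} [∀ i, Category.{w} (K i)] (U : ∀ i, K i ⥤ Type w)

lemma faithful_disjointUnion (hU : ∀ i, (U i).Faithful) : (disjointUnion U).Faithful where
  map_injective {A B} f g h := by
    funext i
    refine (U i).map_injective ?_
    ext x
    have hx : (⟨i, (U i).map (f i) x⟩ : Σ i, (U i).obj (B i)) = ⟨i, (U i).map (g i) x⟩ :=
      ConcreteCategory.congr_hom h (⟨i, x⟩ : Σ i, (U i).obj (A i))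
    exact eq_of_heq (Sigma.mk.inj hx).2

/-- The transition maps do not change the summand of an element, so elements and their
identifications in the colimit can be treated within one summand `i`. -/
lemma preservesDirectedColimits_disjointUnion (hK : ∀ i, HasDirectedColimits.{w} (K i))
    (hU : ∀ i, PreservesDirectedColimits.{w} (U i)) :
    PreservesDirectedColimits.{w} (disjointUnion U) := fun J _ _ _ =>
  ⟨fun {D} => ⟨fun {c} hc => ⟨by
    have hc' (i : I) : IsColimit ((Pi.eval K i ⋙ U i).mapCocone c) :=
      haveI := hU i J
      haveI := preservesDirectedColimits_eval hK i J
      isColimitOfPreserves (Pi.eval K i ⋙ U i) hc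
    refine Types.FilteredColimit.isColimitOf' _ _ ?_ ?_
    · rintro ⟨i, x⟩
      obtain ⟨j, y, hy⟩ := Types.jointly_surjective_of_isColimit (hc' i) x
      exact ⟨j, (⟨i, y⟩ : Σ i, (U i).obj (D.obj j i)), congrArg (Sigma.mk i) hy.symm⟩
    · rintro j ⟨i, x⟩ ⟨i', x'⟩ h
      obtain ⟨hi, hx⟩ := Sigma.mk.inj h
      dsimp only at hi
      subst hi
      obtain ⟨k, f, hf⟩ :=
        (Types.FilteredColimit.isColimit_eq_iff' (hc' i) x x').1 (eq_of_heq hx)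
      exact ⟨k, f, congrArg (Sigma.mk i) hf⟩⟩⟩⟩

end DisjointUnion

/-! ### Final functors between `μ`-filtered categories -/

section Final

variable {C' : Type u₁} [Category.{v₁} C'] {C : Type u₂} [Category.{v₂} C] (Φ : C' ⥤ C)
  [Φ.Faithful] (μ : Cardinal.{w}) [Fact μ.IsRegular] [IsCardinalFiltered C μ]

include Φ in
-- The hypothesis says that any cocone in `C` on a small family from `C'` lifts to `C'` after
-- extending its vertex. It is shared by the inserter and equifier cases.
lemma isCardinalFiltered_of_exists
    (h : ∀ ⦃ι : Type w⦄ (_ : HasCardinalLT ι μ) (a : ι → C') (c : C) (u : ∀ i, Φ.obj (a i) ⟶ c),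
      ∃ (b : C') (v : c ⟶ Φ.obj b) (t : ∀ i, a i ⟶ b), ∀ i, Φ.map (t i) = u i ≫ v) :
    IsCardinalFiltered C' μ := by
  rw [isCardinalFiltered_iff]
  refine ⟨fun ι a hι => ?_, fun ι a b f hι => ?_⟩
  · obtain ⟨b, _, t, _⟩ := h hι a _ (fun i => IsCardinalFiltered.toMax (fun i => Φ.obj (a i)) hι i)
    exact ⟨b, fun i => ⟨t i⟩⟩
  · let g (i : ι) := Φ.map (f i)
    -- The family consists of `a` and `b` with their morphisms to a coequalizing object. The
    -- equations hold after applying `Φ`, hence in `C'` by faithfulness.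
    obtain ⟨d, v, t, ht⟩ := h
      (hasCardinalLT_of_finite (ULift.{w} Bool) _ (Cardinal.IsRegular.aleph0_le Fact.out))
      (fun i => bif i.down then a else b) (IsCardinalFiltered.coeq g hι)
      (fun i => match i with
        | ⟨true⟩ => IsCardinalFiltered.toCoeq g hι
        | ⟨false⟩ => IsCardinalFiltered.coeqHom g hι)
    refine ⟨d, t ⟨false⟩, t ⟨true⟩, fun i => Φ.map_injective ?_⟩
    have h₁ : Φ.map (t ⟨true⟩) = IsCardinalFiltered.toCoeq g hι ≫ v := ht ⟨true⟩
    have h₂ : Φ.map (t ⟨false⟩) = IsCardinalFiltered.coeqHom g hι ≫ v := ht ⟨false⟩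
    refine (Φ.map_comp _ _).trans ?_
    refine Eq.trans ?_ h₁.symm
    rw [h₂, ← IsCardinalFiltered.coeq_condition g hι i, Category.assoc]

omit [Φ.Faithful] in
-- The empty family gives a morphism from `c` to the image of `Φ`; a one-element family, sent to a
-- coequalizer of two such morphisms, makes them agree.
lemma final_of_exists [IsCardinalFiltered C' μ]
    (h : ∀ ⦃ι : Type w⦄ (_ : HasCardinalLT ι μ) (a : ι → C') (c : C) (u : ∀ i, Φ.obj (a i) ⟶ c),
      ∃ (b : C') (v : c ⟶ Φ.obj b) (t : ∀ i, a i ⟶ b), ∀ i, Φ.map (t i) = u i ≫ v) :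
    Φ.Final := by
  have := isFiltered_of_isCardinalFiltered C' μ
  have := isFiltered_of_isCardinalFiltered C μ
  have hμ : Cardinal.aleph0 ≤ μ := Cardinal.IsRegular.aleph0_le Fact.out
  rw [Functor.final_iff_of_isFiltered]
  refine ⟨fun c => ?_, fun {c a} s s' => ?_⟩
  · obtain ⟨b, v, -⟩ := h (hasCardinalLT_of_finite PEmpty.{w + 1} _ hμ) PEmpty.elim c
      (fun i => i.elim)
    exact ⟨b, ⟨v⟩⟩
  · obtain ⟨b, v, t, ht⟩ := h (hasCardinalLT_of_finite PUnit.{w + 1} _ hμ) (fun _ => a) _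
      (fun _ => IsFiltered.coeqHom s s')
    refine ⟨b, t ⟨⟩, ?_⟩
    rw [ht, ← Category.assoc, IsFiltered.coeq_condition, Category.assoc]

end Final

/-! ### Presentable objects and families of morphisms to filtered colimits -/

section Families

variable {L : Type u₂} [Category.{v₂} L] {μ : Cardinal.{w}} [Fact μ.IsRegular]
  {C : Type w} [SmallCategory C] [IsCardinalFiltered C μ]

lemma exists_eq_of_isColimit_family {M : C ⥤ L} {c : Cocone M} (hc : IsColimit c)
    {ι : Type w} (hι : HasCardinalLT ι μ) {Z : ι → L} [∀ i, IsCardinalPresentable (Z i) μ]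
    {j : C} (a b : ∀ i, Z i ⟶ M.obj j) (h : ∀ i, a i ≫ c.ι.app j = b i ≫ c.ι.app j) :
    ∃ (k : C) (t : j ⟶ k), ∀ i, a i ≫ M.map t = b i ≫ M.map t := by
  have := essentiallySmallSelf C
  choose k t ht using fun i => IsCardinalPresentable.exists_eq_of_isColimit' μ hc _ _ (h i)
  obtain ⟨m, s, e, hs⟩ := IsCardinalFiltered.wideSpan t hι
  exact ⟨m, e, fun i => by rw [← hs i, M.map_comp, reassoc_of% (ht i)]⟩

lemma exists_hom_of_isColimit_under {M : C ⥤ L} {c : Cocone M} (hc : IsColimit c)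
    {Z : L} [IsCardinalPresentable Z μ] (f : Z ⟶ c.pt) (j : C) :
    ∃ (k : C) (_ : j ⟶ k) (g : Z ⟶ M.obj k), g ≫ c.ι.app k = f := by
  have := essentiallySmallSelf C
  have := isFiltered_of_isCardinalFiltered C μ
  obtain ⟨k, g, hg⟩ := IsCardinalPresentable.exists_hom_of_isColimit μ hc f
  exact ⟨_, IsFiltered.leftToMax j k, g ≫ M.map (IsFiltered.rightToMax j k), by
    rw [Category.assoc, c.w, hg]⟩

end Families

/-! ### Colimit presentations closed under sequential colimits -/

section Sequential

variable {K : Type u₁} [Category.{v₁} K]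

/-- Every sequence in the index category has a cocone which the given diagram sends to a colimit
cocone. -/
def HasSequentialCocones {C : Type u₂} [Category.{v₂} C] (D : C ⥤ K) : Prop :=
  ∀ T : ℕ ⥤ C, ∃ c : Cocone T, Nonempty (IsColimit (D.mapCocone c))

lemma HasSequentialCocones.of_equivalence {C : Type u₂} [Category.{v₂} C] {C' : Type u₃}
    [Category.{v₃} C'] {D : C ⥤ K} (h : HasSequentialCocones D) (e : C' ⥤ C) [e.IsEquivalence] :
    HasSequentialCocones (e ⋙ D) := fun T => by
  obtain ⟨c, ⟨hc⟩⟩ := h (T ⋙ e)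
  exact ⟨e.mapCoconeInv c,
    ⟨hc.ofIsoColimit ((Cocone.functoriality _ D).mapIso (Functor.mapCoconeMapCoconeInv e c).symm)⟩⟩

/-- An elementary form of the colimit property after applying `F`: existence of `k` constructs
structure morphisms, uniqueness proves equations between them. -/
lemma HasSequentialCocones.exists_colimit {C : Type u₂} [Category.{v₂} C] {D : C ⥤ K}
    (h : HasSequentialCocones D) {L : Type u₃} [Category.{v₃} L] (F : K ⥤ L)
    [PreservesColimitsOfShape ℕ F] {A : ℕ → C} (t : ∀ n, A n ⟶ A (n + 1)) :
    ∃ (s : C) (i : ∀ n, A n ⟶ s), (∀ n, t n ≫ i (n + 1) = i n) ∧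
      ∀ (Z : L) (y : ∀ n, F.obj (D.obj (A n)) ⟶ Z),
        (∀ n, F.map (D.map (t n)) ≫ y (n + 1) = y n) →
        ∃! k : F.obj (D.obj s) ⟶ Z, ∀ n, F.map (D.map (i n)) ≫ k = y n := by
  obtain ⟨s, ⟨hs⟩⟩ := h (Functor.ofSequence t)
  refine ⟨s.pt, s.ι.app, fun n => ?_, fun Z y hy => ?_⟩
  · refine Eq.trans ?_ (s.w (homOfLE n.le_succ))
    exact congrArg (· ≫ s.ι.app (n + 1)) (Functor.ofSequence_map_homOfLE_succ t n).symm
  · have hF := isColimitOfPreserves F hs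
    let α : (Functor.ofSequence t ⋙ D) ⋙ F ⟶ (Functor.const ℕ).obj Z :=
      NatTrans.ofSequence y (fun n => by
        refine Eq.trans ?_ (Category.comp_id _).symm
        refine Eq.trans ?_ (hy n)
        exact congrArg (fun x => F.map (D.map x) ≫ y (n + 1))
          (Functor.ofSequence_map_homOfLE_succ t n))
    exact ⟨hF.desc ⟨_, α⟩, hF.fac ⟨_, α⟩, fun k hk => hF.uniq ⟨_, α⟩ k hk⟩

variable (μ : Cardinal.{w}) [Fact μ.IsRegular]

/-- Since `μ` is uncountable, the colimit of a sequence of `μ`-presentable objects is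
`μ`-presentable; with the induced morphism to `X` it is again an object over `X`. -/
lemma hasSequentialCocones_presentableOver [LocallySmall.{w} K] (hK : HasDirectedColimits.{w} K)
    (hμ : Cardinal.aleph0 < μ) (X : K) :
    HasSequentialCocones (CostructuredArrow.proj (isCardinalPresentable K μ).ι X ⋙
      (isCardinalPresentable K μ).ι) := fun T => by
  have := hK.hasColimitsOfShape_nat
  let D := T ⋙ CostructuredArrow.proj (isCardinalPresentable K μ).ι X ⋙
    (isCardinalPresentable K μ).ι
  have (n : ℕ) : IsCardinalPresentable (D.obj n) μ := (T.obj n).left.property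
  have hN : HasCardinalLT (Arrow ℕ) μ := by
    have hN' : HasCardinalLT ℕ μ := by simpa [HasCardinalLT] using hμ
    exact (hasCardinalLT_prod hμ.le hN' hN').of_injective (fun f : Arrow ℕ => (f.left, f.right)) (by
      rintro ⟨a, b, f⟩ ⟨a', b', f'⟩ h
      obtain ⟨rfl, rfl⟩ := Prod.mk.inj h
      obtain rfl : f = f' := Subsingleton.elim _ _
      rfl)
  let s : Cocone D :=
    { pt := X
      ι :=
        { app n := (T.obj n).hom
          naturality _ _ f := (CostructuredArrow.w (T.map f)).trans (Category.comp_id _).symm } }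
  let A : (isCardinalPresentable K μ).FullSubcategory :=
    ⟨colimit D, isCardinalPresentable_of_isColimit _ (colimit.isColimit D) μ hN⟩
  let c : Cocone T :=
    { pt := CostructuredArrow.mk (S := (isCardinalPresentable K μ).ι) (Y := A) (colimit.desc D s)
      ι :=
        { app n := CostructuredArrow.homMk (ObjectProperty.homMk (colimit.ι D n))
            (colimit.ι_desc s n)
          naturality _ _ f := by
            ext
            exact (colimit.w D f).trans (Category.comp_id _).symm } }
  exact ⟨c, ⟨colimit.isColimit D⟩⟩

lemma exists_presentation_hasSequentialCocones (hK : HasDirectedColimits.{w} K)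
    (hμ : Cardinal.aleph0 < μ) [IsCardinalAccessibleCategory K μ] (X : K) :
    ∃ (C : Type w) (_ : SmallCategory C) (_ : IsCardinalFiltered C μ)
      (p : (isCardinalPresentable K μ).ColimitOfShape C X), HasSequentialCocones p.diag := by
  let e := equivSmallModel.{w} (CostructuredArrow (isCardinalPresentable K μ).ι X)
  refine ⟨_, _, IsCardinalFiltered.of_equivalence μ e,
    { diag := e.inverse ⋙ CostructuredArrow.proj (isCardinalPresentable K μ).ι X ⋙
        (isCardinalPresentable K μ).ι
      ι := _
      isColimit := ((isCardinalPresentable K μ).ι.denseAt X).whiskerEquivalence e.symm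
      prop_diag_obj j := (e.inverse.obj j).left.property }, ?_⟩
  exact (hasSequentialCocones_presentableOver μ hK hμ X).of_equivalence e.inverse

end Sequential

/-! ### Colimits in inserter categories -/

namespace Ins

variable {K : Type u₁} [Category.{v₁} K] {L : Type u₂} [Category.{v₂} L] {F G : K ⥤ L}

instance : (proj F G).Faithful where
  map_injective h := Hom.ext h

/-- Isomorphisms of the inserter category. -/
def isoMk {A B : Ins F G} (e : A.pt ≅ B.pt) (h : F.map e.hom ≫ B.str = A.str ≫ G.map e.hom) :
    A ≅ B where
  hom := { hom := e.hom, w := h }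
  inv :=
    { hom := e.inv
      w := by
        rw [← cancel_epi (F.map e.hom), ← Category.assoc, ← F.map_comp, ← Category.assoc, h,
          Category.assoc, ← G.map_comp, e.hom_inv_id, F.map_id, G.map_id,
          Category.id_comp, Category.comp_id] }
  hom_inv_id := Hom.ext e.hom_inv_id
  inv_hom_id := Hom.ext e.inv_hom_id

lemma str_comp_map {A B : Ins F G} (f : A ⟶ B) {Z : K} {x : A.pt ⟶ Z} {y : B.pt ⟶ Z}
    (h : f.hom ≫ y = x) : F.map f.hom ≫ B.str ≫ G.map y = A.str ≫ G.map x := by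
  rw [← Category.assoc, f.w, Category.assoc, ← G.map_comp, h]

lemma map_comp_str_of_fac {A B C : Ins F G} (f : A ⟶ B) (g : A ⟶ C) (d : B.pt ⟶ C.pt)
    (h : f.hom ≫ d = g.hom) : F.map f.hom ≫ F.map d ≫ C.str = F.map f.hom ≫ B.str ≫ G.map d := by
  rw [str_comp_map f h, ← Category.assoc, ← F.map_comp, h, g.w]

lemma map_comp_str_comp_map {A B C : Ins F G} (u : B ⟶ C) (f : A ⟶ C) (g : A.pt ⟶ B.pt)
    (h : g ≫ u.hom = f.hom) :
    (F.map g ≫ B.str) ≫ G.map u.hom = (A.str ≫ G.map g) ≫ G.map u.hom := by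
  rw [Category.assoc, ← u.w, ← F.map_comp_assoc, Category.assoc, ← G.map_comp, h, f.w]

/-- A morphism between underlying objects becomes a morphism of the inserter category after
composition with a morphism which makes it compatible with the structure morphisms. -/
def homOfComp {A B C : Ins F G} (g : A.pt ⟶ B.pt) (t : B ⟶ C)
    (h : (F.map g ≫ B.str) ≫ G.map t.hom = (A.str ≫ G.map g) ≫ G.map t.hom) : A ⟶ C where
  hom := g ≫ t.hom
  w := by
    rw [F.map_comp, Category.assoc, t.w, ← Category.assoc, h, Category.assoc, ← G.map_comp]

section Colimits

variable {J : Type u₃} [Category.{v₃} J]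

/-- The morphism induced in `K` respects the structure morphisms because this can be tested on the
legs of the colimit after applying `F`. -/
lemma nonempty_isColimit {D : J ⥤ Ins F G} [PreservesColimit (D ⋙ proj F G) F] {c : Cocone D}
    (hc : IsColimit ((proj F G).mapCocone c)) : Nonempty (IsColimit c) :=
  ⟨{ desc s :=
      { hom := hc.desc ((proj F G).mapCocone s)
        w := by
          refine (isColimitOfPreserves F hc).hom_ext fun j => ?_
          exact map_comp_str_of_fac (c.ι.app j) (s.ι.app j) _
            (hc.fac ((proj F G).mapCocone s) j) }
     fac s j := Hom.ext (hc.fac ((proj F G).mapCocone s) j)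
     uniq s m hm := Hom.ext (hc.uniq ((proj F G).mapCocone s) m.hom
      fun j => congrArg Hom.hom (hm j)) }⟩

variable (F G J) [HasColimitsOfShape J K] [PreservesColimitsOfShape J F]

lemma exists_isColimit (D : J ⥤ Ins F G) :
    ∃ c : Cocone D, Nonempty (IsColimit ((proj F G).mapCocone c)) := by
  let E := D ⋙ proj F G
  let hF := isColimitOfPreserves F (colimit.isColimit E)
  let t : Cocone (E ⋙ F) :=
    { pt := G.obj (colimit E)
      ι :=
        { app j := (D.obj j).str ≫ G.map (colimit.ι E j)
          naturality i j f := by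
            refine Eq.trans ?_ (Category.comp_id _).symm
            exact str_comp_map (D.map f) (colimit.w E f) } }
  exact ⟨{
    pt := { pt := colimit E, str := hF.desc t }
    ι :=
      { app j := { hom := colimit.ι E j, w := hF.fac t j }
        naturality i j f := Hom.ext ((colimit.w E f).trans (Category.comp_id _).symm) } },
    ⟨colimit.isColimit E⟩⟩

lemma hasColimitsOfShape : HasColimitsOfShape J (Ins F G) where
  has_colimit D := by
    obtain ⟨c, ⟨hc⟩⟩ := exists_isColimit F G J D
    obtain ⟨hc'⟩ := nonempty_isColimit hc
    exact ⟨⟨c, hc'⟩⟩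

lemma preservesColimitsOfShape_proj : PreservesColimitsOfShape J (proj F G) where
  preservesColimit {D} := by
    obtain ⟨c, ⟨hc⟩⟩ := exists_isColimit F G J D
    obtain ⟨hc'⟩ := nonempty_isColimit hc
    exact preservesColimit_of_preserves_colimit_cocone hc' hc

variable {F G J}

omit [HasColimitsOfShape J K] in
lemma preservesColimitsOfShape_of_comp_proj {X : Type*} [Category* X] (H : X ⥤ Ins F G)
    [PreservesColimitsOfShape J (H ⋙ proj F G)] : PreservesColimitsOfShape J H where
  preservesColimit {D} :=
    { preserves hc :=
        haveI : PreservesColimit ((D ⋙ H) ⋙ proj F G) F := inferInstance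
        nonempty_isColimit (isColimitOfPreserves (H ⋙ proj F G) hc) }

end Colimits

/-! ### Accessibility of inserter categories -/

section Presentable

variable {μ : Cardinal.{w}} [Fact μ.IsRegular]

lemma isCardinalPresentable [HasCardinalFilteredColimits K μ] [F.IsCardinalAccessible μ]
    [G.IsCardinalAccessible μ] (A : Ins F G) [IsCardinalPresentable A.pt μ]
    [IsCardinalPresentable (F.obj A.pt) μ] : IsCardinalPresentable A μ where
  preservesColimitOfShape J _ _ := ⟨fun {D} => ⟨fun {c} hc => ⟨by
    have := HasCardinalFilteredColimits.hasColimitsOfShape K μ J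
    have := F.preservesColimitsOfShape_of_isCardinalAccessible μ J
    have := G.preservesColimitsOfShape_of_isCardinalAccessible μ J
    have := preservesColimitsOfShape_proj F G J
    have := isFiltered_of_isCardinalFiltered J μ
    have := essentiallySmallSelf J
    have hK := isColimitOfPreserves (proj F G) hc
    have hL := isColimitOfPreserves (proj F G ⋙ G) hc
    refine Types.FilteredColimit.isColimitOf' _ _ (fun f => ?_) (fun j f g h => ?_)
    · obtain ⟨j, g, hg⟩ := IsCardinalPresentable.exists_hom_of_isColimit μ hK (X := A.pt) f.hom
      -- `g` respects the structure morphisms only after composition to the colimit. As `F.obj A.pt`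
      -- is `μ`-presentable and `G` preserves the colimit, it does so already at some stage `k`.
      obtain ⟨k, t, ht⟩ := IsCardinalPresentable.exists_eq_of_isColimit' μ hL
        (F.map g ≫ (D.obj j).str) (A.str ≫ G.map g) (map_comp_str_comp_map (c.ι.app j) f g hg)
      refine ⟨k, homOfComp g (D.map t) ht, Hom.ext ?_⟩
      refine hg.symm.trans ?_
      refine Eq.trans ?_ (Category.assoc g (D.map t).hom (c.ι.app k).hom).symm
      exact congrArg (g ≫ ·) (congrArg Hom.hom (c.w t)).symm
    · obtain ⟨k, t, ht⟩ := IsCardinalPresentable.exists_eq_of_isColimit' μ hK (X := A.pt)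
        f.hom g.hom (congrArg Hom.hom h)
      exact ⟨k, t, Hom.ext ht⟩⟩⟩⟩

lemma essentiallySmall_of_proj [LocallySmall.{w} K] [LocallySmall.{w} L] (P : ObjectProperty K)
    [ObjectProperty.EssentiallySmall.{w} P] :
    ObjectProperty.EssentiallySmall.{w} (P.inverseImage (proj F G)) := by
  obtain ⟨Q, _, -, hQ⟩ := ObjectProperty.EssentiallySmall.exists_small_le.{w} P
  have : ObjectProperty.Small.{w} (Q.inverseImage (proj F G)) :=
    small_of_injective (β := Σ B : Subtype Q, (F.obj B.1 ⟶ G.obj B.1))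
      (f := fun A => ⟨⟨A.1.pt, A.2⟩, A.1.str⟩) (by
        rintro ⟨⟨A, a⟩, hA⟩ ⟨⟨B, b⟩, hB⟩ h
        obtain ⟨h₁, h₂⟩ := Sigma.mk.inj h
        obtain rfl : A = B := congrArg Subtype.val h₁
        obtain rfl : a = b := eq_of_heq h₂
        rfl)
  refine ⟨Q.inverseImage (proj F G), inferInstance, fun A hA => ?_⟩
  obtain ⟨B, hB, ⟨(e : A.pt ≅ B)⟩⟩ := hQ _ hA
  exact ⟨{ pt := B, str := F.map e.inv ≫ A.str ≫ G.map e.hom }, hB,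
    ⟨isoMk e (by
      change F.map e.hom ≫ F.map e.inv ≫ A.str ≫ G.map e.hom = A.str ≫ G.map e.hom
      rw [← F.map_comp_assoc, e.hom_inv_id, F.map_id, Category.id_comp])⟩⟩

end Presentable

end Ins

namespace Ins

variable {K : Type u₁} [Category.{w} K] {L : Type u₂} [Category.{w} L] {F G : K ⥤ L}

/-! ### Approximating a structure morphism on the objects of a presentation -/

section Approximation

variable {C : Type w} [SmallCategory C] {X : K} (p : ColimitPresentation C X)
  (f : F.obj X ⟶ G.obj X)

/-- The leg of a colimit presentation at an object. -/
def leg (c : C) : p.diag.obj c ⟶ X := p.ι.app c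

lemma map_leg {c d : C} (t : c ⟶ d) : p.diag.map t ≫ leg p d = leg p c := p.w t

/-- An approximation of a morphism `f : F X ⟶ G X` on objects of a presentation of `X`. -/
structure Stage where
  src : C
  tgt : C
  t : src ⟶ tgt
  h : F.obj (p.diag.obj src) ⟶ G.obj (p.diag.obj tgt)
  w : h ≫ G.map (leg p tgt) = F.map (leg p src) ≫ f

variable {μ : Cardinal.{w}} [Fact μ.IsRegular] [IsCardinalFiltered C μ]
  [F.IsCardinalAccessible μ] [G.IsCardinalAccessible μ]

section

variable (hF : ∀ c, IsCardinalPresentable (F.obj (p.diag.obj c)) μ)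

include hF

omit [F.IsCardinalAccessible μ] in
lemma exists_stage (c : C) : ∃ (d : C) (_ : c ⟶ d) (h : F.obj (p.diag.obj c) ⟶ G.obj (p.diag.obj d)),
    h ≫ G.map (leg p d) = F.map (leg p c) ≫ f := by
  have := G.preservesColimitsOfShape_of_isCardinalAccessible μ C
  have := hF c
  exact exists_hom_of_isColimit_under (μ := μ) (isColimitOfPreserves G p.isColimit)
    (F.map (leg p c) ≫ f) c

omit [F.IsCardinalAccessible μ] in
-- A lift of `f` to a later stage agrees with the given `g i` after passing to `G.obj X`; these
-- fewer than `μ` equations then hold simultaneously further along the diagram.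
lemma exists_stage_of_family {ι : Type w} (hι : HasCardinalLT ι μ) {a : ι → C} {c : C}
    (u : ∀ i, a i ⟶ c) (g : ∀ i, F.obj (p.diag.obj (a i)) ⟶ G.obj (p.diag.obj c))
    (hg : ∀ i, g i ≫ G.map (leg p c) = F.map (leg p (a i)) ≫ f) :
    ∃ (d : C) (t : c ⟶ d) (h : F.obj (p.diag.obj c) ⟶ G.obj (p.diag.obj d)),
      h ≫ G.map (leg p d) = F.map (leg p c) ≫ f ∧
      ∀ i, g i ≫ G.map (p.diag.map t) = F.map (p.diag.map (u i)) ≫ h := by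
  have := G.preservesColimitsOfShape_of_isCardinalAccessible μ C
  obtain ⟨d, t, h, hh⟩ := exists_stage p f hF c
  have := fun i => hF (a i)
  obtain ⟨e, s, hs⟩ := exists_eq_of_isColimit_family (μ := μ)
    (isColimitOfPreserves G p.isColimit) hι
    (Z := fun i => F.obj (p.diag.obj (a i))) (j := d)
    (fun i => g i ≫ G.map (p.diag.map t)) (fun i => F.map (p.diag.map (u i)) ≫ h) (fun i => by
      change (g i ≫ G.map (p.diag.map t)) ≫ G.map (leg p d) =
        (F.map (p.diag.map (u i)) ≫ h) ≫ G.map (leg p d)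
      rw [Category.assoc, ← G.map_comp, map_leg, hg, Category.assoc, hh, ← F.map_comp_assoc,
        map_leg])
  refine ⟨e, t ≫ s, h ≫ G.map (p.diag.map s), ?_, fun i => ?_⟩
  · rw [Category.assoc, ← G.map_comp, map_leg, hh]
  · have hs' : (g i ≫ G.map (p.diag.map t)) ≫ G.map (p.diag.map s) =
      (F.map (p.diag.map (u i)) ≫ h) ≫ G.map (p.diag.map s) := hs i
    rw [p.diag.map_comp, G.map_comp, ← Category.assoc, hs', Category.assoc]

omit [F.IsCardinalAccessible μ] in
lemma exists_stage_sequence (s : Stage p f) :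
    ∃ (A : ℕ → C) (t : ∀ n, A n ⟶ A (n + 1))
      (h : ∀ n, F.obj (p.diag.obj (A n)) ⟶ G.obj (p.diag.obj (A (n + 1)))),
      (∀ n, h n ≫ G.map (leg p (A (n + 1))) = F.map (leg p (A n)) ≫ f) ∧
      (∀ n, h n ≫ G.map (p.diag.map (t (n + 1))) = F.map (p.diag.map (t n)) ≫ h (n + 1)) ∧
      -- The initial data are compared as one dependent tuple, so that a single `cases` substitutes
      -- all of them.
      (⟨A 0, A 1, t 0, h 0⟩ : Σ' (a b : C) (_ : a ⟶ b),
        F.obj (p.diag.obj a) ⟶ G.obj (p.diag.obj b)) = ⟨s.src, s.tgt, s.t, s.h⟩ := by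
  choose d t h hh hs using fun s : Stage p f =>
    exists_stage_of_family p f hF (hasCardinalLT_of_finite PUnit.{w + 1} μ
      (Cardinal.IsRegular.aleph0_le Fact.out)) (fun _ => s.t) (fun _ => s.h) (fun _ => s.w)
  -- Each stage starts at the target of the previous one, so `h n` goes from `A n` to `A (n + 1)`.
  let st (n : ℕ) : Stage p f := n.rec s fun _ s => ⟨s.tgt, d s, t s, h s, hh s⟩
  exact ⟨fun n => (st n).src, fun n => (st n).t, fun n => (st n).h, fun n => (st n).w,
    fun n => hs (st n) ⟨⟩, rfl⟩

omit [F.IsCardinalAccessible μ] in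
/-- Every object of the presentation maps to one which carries an approximation of `f`,
compatibly with a small family of given approximations. -/
lemma exists_approximation (hp : HasSequentialCocones p.diag) [PreservesColimitsOfShape ℕ F]
    {ι : Type w} (hι : HasCardinalLT ι μ) {a : ι → C} {c : C} (u : ∀ i, a i ⟶ c)
    (g : ∀ i, F.obj (p.diag.obj (a i)) ⟶ G.obj (p.diag.obj (a i)))
    (hg : ∀ i, g i ≫ G.map (leg p (a i)) = F.map (leg p (a i)) ≫ f) :
    ∃ (b : C) (v : c ⟶ b) (h : F.obj (p.diag.obj b) ⟶ G.obj (p.diag.obj b)),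
      h ≫ G.map (leg p b) = F.map (leg p b) ≫ f ∧
      ∀ i, F.map (p.diag.map (u i ≫ v)) ≫ h = g i ≫ G.map (p.diag.map (u i ≫ v)) := by
  obtain ⟨d, t₀, h₀, hh₀, hu⟩ := exists_stage_of_family p f hF hι u
    (fun i => g i ≫ G.map (p.diag.map (u i))) (fun i => by
      rw [Category.assoc, ← G.map_comp, map_leg, hg])
  obtain ⟨A, t, h, hw, ht, h0⟩ := exists_stage_sequence p f hF ⟨c, d, t₀, h₀, hh₀⟩
  cases h0
  obtain ⟨s, i, hi, hs⟩ := hp.exists_colimit F t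
  -- The shift by one in `h n` disappears in the colimit: followed by the inclusions at `n + 1`,
  -- these morphisms form a cocone and induce an endo-stage `k` at `s`.
  obtain ⟨k, hk, -⟩ := hs _ (fun n => h n ≫ G.map (p.diag.map (i (n + 1)))) (fun n => by
    rw [← Category.assoc, ← ht, Category.assoc, ← G.map_comp, ← p.diag.map_comp, hi])
  refine ⟨s, i 0, k, ?_, fun j => ?_⟩
  -- Compatibility of `k` with `f` follows from uniqueness of morphisms out of the sequential
  -- colimit.
  · refine (hs _ (fun n => F.map (leg p (A n)) ≫ f) (fun n => by
      rw [← F.map_comp_assoc, map_leg])).unique (fun n => ?_) (fun n => ?_)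
    · rw [← Category.assoc, hk, Category.assoc, ← G.map_comp, map_leg, hw]
    · rw [← F.map_comp_assoc, map_leg]
  · rw [p.diag.map_comp, F.map_comp, Category.assoc, hk, ← Category.assoc, ← hu, G.map_comp,
      ← hi 0]
    simp only [Category.assoc, Functor.map_comp]

end

/-- The category of approximations of `f` on objects of the presentation. -/
abbrev Approx :=
  ObjectProperty.FullSubcategory
    (fun A : Ins (p.diag ⋙ F) (p.diag ⋙ G) => A.str ≫ G.map (leg p A.pt) = F.map (leg p A.pt) ≫ f)

/-- The forgetful functor from approximations to the index category of the presentation. -/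
abbrev approxIndex : Approx p f ⥤ C :=
  ObjectProperty.ι _ ⋙ proj _ _

/-- The functor sending an approximation to an object of the inserter category. -/
def approxDiag : Approx p f ⥤ Ins F G where
  obj A := { pt := p.diag.obj A.obj.pt, str := A.obj.str }
  map t := { hom := p.diag.map t.hom.hom, w := t.hom.w }
  map_id A := Hom.ext (p.diag.map_id A.obj.pt)
  map_comp s t := Hom.ext (p.diag.map_comp s.hom.hom t.hom.hom)

/-- The cocone exhibiting an object of the inserter category as the colimit of its
approximations. -/
def approxCocone : Cocone (approxDiag p f) where
  pt := { pt := X, str := f }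
  ι :=
    { app A := { hom := leg p A.obj.pt, w := A.property.symm }
      naturality _ _ t := Hom.ext
        ((map_leg p t.hom.hom).trans (Category.comp_id _).symm) }

variable (hF : ∀ c, IsCardinalPresentable (F.obj (p.diag.obj c)) μ)
  (hp : HasSequentialCocones p.diag) [PreservesColimitsOfShape ℕ F]

include hF hp

omit [F.IsCardinalAccessible μ] in
lemma exists_approx ⦃ι : Type w⦄ (hι : HasCardinalLT ι μ) (a : ι → Approx p f) (c : C)
    (u : ∀ i, (approxIndex p f).obj (a i) ⟶ c) :
    ∃ (b : Approx p f) (v : c ⟶ (approxIndex p f).obj b) (t : ∀ i, a i ⟶ b),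
      ∀ i, (approxIndex p f).map (t i) = u i ≫ v := by
  obtain ⟨b, v, h, hb, hu⟩ := exists_approximation p f hF hp hι u (fun i => (a i).obj.str)
    (fun i => (a i).property)
  exact ⟨⟨{ pt := b, str := h }, hb⟩, v,
    fun i => ObjectProperty.homMk { hom := u i ≫ v, w := hu i }, fun i => rfl⟩

omit [F.IsCardinalAccessible μ] in
lemma isCardinalFiltered_approx : IsCardinalFiltered (Approx p f) μ :=
  isCardinalFiltered_of_exists (approxIndex p f) μ (exists_approx p f hF hp)

/-- The index functor from approximations to `C` is final, so `X` is still the colimit of the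
underlying objects, and the projection reflects this colimit. -/
lemma nonempty_isColimit_approxCocone : Nonempty (IsColimit (approxCocone p f)) := by
  have := isCardinalFiltered_approx p f hF hp
  have := final_of_exists (approxIndex p f) μ (exists_approx p f hF hp)
  have := F.preservesColimitsOfShape_of_isCardinalAccessible μ (Approx p f)
  exact nonempty_isColimit
    ((Functor.Final.isColimitWhiskerEquiv (approxIndex p f) p.cocone).symm p.isColimit)

end Approximation

section Accessible

variable {μ : Cardinal.{w}} [Fact μ.IsRegular]

lemma isCardinalAccessibleCategory [IsCardinalAccessibleCategory K μ]
    (hμ : Cardinal.aleph0 < μ)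
    (hK : HasDirectedColimits.{w} K) (hF : PreservesDirectedColimits.{w} F)
    (hG : PreservesDirectedColimits.{w} G)
    (h : ∀ A : K, IsCardinalPresentable A μ → IsCardinalPresentable (F.obj A) μ) :
    IsCardinalAccessibleCategory (Ins F G) μ := by
  have := hF.isCardinalAccessible μ
  have := hG.isCardinalAccessible μ
  have := hF.preservesColimitsOfShape_nat
  let Q := (CategoryTheory.isCardinalPresentable K μ).inverseImage (proj F G)
  have : ObjectProperty.EssentiallySmall.{w} Q := essentiallySmall_of_proj _
  have hQ : Q.IsCardinalFilteredGenerator μ :=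
    { le_isCardinalPresentable := fun A (hA : IsCardinalPresentable A.pt μ) =>
        haveI := h _ hA
        isCardinalPresentable A
      exists_colimitsOfShape := fun A => by
        obtain ⟨C, _, _, p, hp⟩ := exists_presentation_hasSequentialCocones μ hK hμ A.pt
        have hF' (c : C) := h _ (p.prop_diag_obj c)
        obtain ⟨hc⟩ := nonempty_isColimit_approxCocone p.toColimitPresentation A.str hF' hp
        exact ⟨_, inferInstance,
          isCardinalFiltered_approx p.toColimitPresentation A.str hF' hp,
          ⟨{ diag := approxDiag p.toColimitPresentation A.str
             ι := (approxCocone p.toColimitPresentation A.str).ι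
             isColimit := hc
             prop_diag_obj := fun (a : Approx p.toColimitPresentation A.str) => p.prop_diag_obj a.obj.pt }⟩⟩ }
  have := hQ.hasCardinalFilteredGenerator
  have : HasCardinalFilteredColimits (Ins F G) μ := ⟨fun J _ _ =>
    haveI := HasCardinalFilteredColimits.hasColimitsOfShape K μ J
    haveI := F.preservesColimitsOfShape_of_isCardinalAccessible μ J
    hasColimitsOfShape F G J⟩
  constructor

end Accessible

end Ins

/-- For functors out of an accessible category with directed colimits into an accessible category
which preserve directed colimits, there are regular cardinals `μ` such that the domain is
`μ`-accessible and the functor preserves `μ`-presentable objects. -/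
lemma PreservesDirectedColimits.exists_cardinal {K : Type u₁} [Category.{v₁} K]
    {L : Type u₂} [Category.{v₂} L] [hK' : IsAccessibleCategory.{w} K]
    [hL' : IsAccessibleCategory.{w} L] (hK : HasDirectedColimits.{w} K) {F : K ⥤ L}
    (hF : PreservesDirectedColimits.{w} F) :
    ∃ (μ : Cardinal.{w}) (_ : Fact μ.IsRegular), Cardinal.aleph0 < μ ∧
      IsCardinalAccessibleCategory K μ ∧
      ∀ A : K, IsCardinalPresentable A μ → IsCardinalPresentable (F.obj A) μ := by
  obtain ⟨κ, _, _⟩ := hK'.exists_cardinal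
  obtain ⟨_, _, _⟩ := hL'.exists_cardinal
  obtain ⟨P, _, hP⟩ := HasCardinalFilteredGenerator.exists_small_generator K κ
  choose ν hν hν' using fun A : Shrink.{w} (Subtype P) =>
    (inferInstance : IsPresentable.{w} (F.obj ((equivShrink (Subtype P)).symm A).1)).exists_cardinal
  -- `none` carries the index `κ` of `K`, and `some b` the presentability rank of the image of the
  -- generator `b`.
  obtain ⟨μ, _, hμ, -, hlt⟩ := exists_regular_ge (fun o : Option (Shrink.{w} (Subtype P)) =>
    o.elim κ ν)
  have hκ : κ < μ := hlt none
  refine ⟨μ, inferInstance, hμ, hK.isCardinalAccessibleCategory_of_le hκ.le, fun A _ => ?_⟩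
  refine hF.isCardinalPresentable_obj hK hκ hP (fun B hB => ?_) A
  obtain ⟨b, hb⟩ := (equivShrink (Subtype P)).symm.surjective ⟨B, hB⟩
  have hB' := isCardinalPresentable_of_le (κ := ν b) (F.obj ((equivShrink (Subtype P)).symm b).1)
    (hlt (some b)).le
  rwa [hb] at hB'

namespace Ins

variable {K : Type u₁} [Category.{w} K] {L : Type u₂} [Category.{w} L] {F G : K ⥤ L}

lemma isAccessibleCategory [IsAccessibleCategory.{w} K] [hL : IsAccessibleCategory.{w} L]
    (hK : HasDirectedColimits.{w} K) (hF : PreservesDirectedColimits.{w} F)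
    (hG : PreservesDirectedColimits.{w} G) : IsAccessibleCategory.{w} (Ins F G) := by
  obtain ⟨_, _, _⟩ := hL.exists_cardinal
  obtain ⟨μ, _, hμ, _, h⟩ := hF.exists_cardinal hK
  exact ⟨μ, inferInstance, isCardinalAccessibleCategory hμ hK hF hG h⟩

lemma hasDirectedColimits (hK : HasDirectedColimits.{w} K) (hF : PreservesDirectedColimits.{w} F) :
    HasDirectedColimits.{w} (Ins F G) := fun J _ _ _ =>
  haveI := hK J
  haveI := hF J
  hasColimitsOfShape F G J

lemma preservesDirectedColimits_proj (hK : HasDirectedColimits.{w} K)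
    (hF : PreservesDirectedColimits.{w} F) :
    PreservesDirectedColimits.{w} (proj F G) := fun J _ _ _ =>
  haveI := hK J
  haveI := hF J
  preservesColimitsOfShape_proj F G J

lemma preservesDirectedColimits_of_comp_proj (hF : PreservesDirectedColimits.{w} F) {X : Type*}
    [Category* X] {H : X ⥤ Ins F G} (hH : PreservesDirectedColimits.{w} (H ⋙ proj F G)) :
    PreservesDirectedColimits.{w} H := fun J _ _ _ =>
  haveI := hH J
  haveI := hF J
  preservesColimitsOfShape_of_comp_proj H

lemma isAccessible_of_comp_proj (hF : PreservesDirectedColimits.{w} F) {X : Type*}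
    [Category* X] {H : X ⥤ Ins F G} (hH : (H ⋙ proj F G).IsAccessible.{w}) :
    H.IsAccessible.{w} := by
  obtain ⟨κ, _, _⟩ := hH.exists_cardinal
  have := hF.isCardinalAccessible κ
  exact ⟨κ, inferInstance, ⟨fun J _ _ =>
    haveI := (H ⋙ proj F G).preservesColimitsOfShape_of_isCardinalAccessible κ J
    haveI := F.preservesColimitsOfShape_of_isCardinalAccessible κ J
    preservesColimitsOfShape_of_comp_proj H⟩⟩

end Ins

/-! ### Colimits in equifier categories -/

namespace Eqf

section Colimits

variable {K : Type u₁} [Category.{v₁} K] {L : Type u₂} [Category.{v₂} L] {F G : K ⥤ L}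
  (φ ψ : F ⟶ G) (J : Type u₃) [Category.{v₃} J]

lemma isClosedUnderColimitsOfShape [PreservesColimitsOfShape J F] :
    (eqProp φ ψ).IsClosedUnderColimitsOfShape J where
  colimitsOfShape_le A := by
    rintro ⟨p⟩
    refine (isColimitOfPreserves F p.isColimit).hom_ext fun j => ?_
    have hj : φ.app (p.diag.obj j) = ψ.app (p.diag.obj j) := p.prop_diag_obj j
    refine (φ.naturality (p.ι.app j)).trans (Eq.trans ?_ (ψ.naturality (p.ι.app j)).symm)
    exact congrArg (· ≫ G.map (p.ι.app j)) hj

lemma essentiallySmall_inverseImage_ι (P : ObjectProperty K)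
    [ObjectProperty.EssentiallySmall.{w} P] :
    ObjectProperty.EssentiallySmall.{w} (P.inverseImage (eqProp φ ψ).ι) := by
  obtain ⟨Q, _, -, hQ⟩ := ObjectProperty.EssentiallySmall.exists_small_le.{w} P
  have : ObjectProperty.Small.{w} (Q.inverseImage (eqProp φ ψ).ι) :=
    small_of_injective (β := Subtype Q) (f := fun A => ⟨A.1.obj, A.2⟩) (by
      rintro ⟨⟨A, a⟩, hA⟩ ⟨⟨B, b⟩, hB⟩ h
      obtain rfl : A = B := congrArg Subtype.val h
      rfl)
  refine ⟨Q.inverseImage (eqProp φ ψ).ι, inferInstance, fun A hA => ?_⟩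
  obtain ⟨B, hB, ⟨(e : A.obj ≅ B)⟩⟩ := hQ _ hA
  have hB' : eqProp φ ψ B := by
    have hA' : φ.app A.obj = ψ.app A.obj := A.property
    change φ.app B = ψ.app B
    rw [← cancel_epi (F.map e.hom), φ.naturality, ψ.naturality, hA']
  exact ⟨⟨B, hB'⟩, hB, ⟨ObjectProperty.isoMk _ e⟩⟩

lemma isCardinalPresentable_of_obj {μ : Cardinal.{w}} [Fact μ.IsRegular]
    [HasCardinalFilteredColimits K μ] [F.IsCardinalAccessible μ] (A : Eqf φ ψ)
    [IsCardinalPresentable A.obj μ] : IsCardinalPresentable A μ where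
  preservesColimitOfShape J _ _ := ⟨fun {D} => ⟨fun {c} hc => ⟨by
    have := HasCardinalFilteredColimits.hasColimitsOfShape K μ J
    have := F.preservesColimitsOfShape_of_isCardinalAccessible μ J
    have := isClosedUnderColimitsOfShape φ ψ J
    have := isFiltered_of_isCardinalFiltered J μ
    have := essentiallySmallSelf J
    have hK := isColimitOfPreserves (eqProp φ ψ).ι hc
    refine Types.FilteredColimit.isColimitOf' _ _ (fun f => ?_) (fun j f g h => ?_)
    · obtain ⟨j, g, hg⟩ := IsCardinalPresentable.exists_hom_of_isColimit μ hK (X := A.obj) f.hom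
      exact ⟨j, ObjectProperty.homMk g, ObjectProperty.hom_ext _ hg.symm⟩
    · obtain ⟨k, t, ht⟩ := IsCardinalPresentable.exists_eq_of_isColimit' μ hK (X := A.obj)
        f.hom g.hom (congrArg (fun k => k.hom) h)
      exact ⟨k, t, ObjectProperty.hom_ext _ ht⟩⟩⟩⟩

end Colimits

/-! ### Accessibility of equifier categories -/

variable {K : Type u₁} [Category.{w} K] {L : Type u₂} [Category.{w} L] {F G : K ⥤ L}
  {φ ψ : F ⟶ G}

section Presentation

variable {C : Type w} [SmallCategory C] {X : K} (p : ColimitPresentation C X)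
  {μ : Cardinal.{w}} [Fact μ.IsRegular] [IsCardinalFiltered C μ]
  [G.IsCardinalAccessible μ]
  (hF : ∀ c, IsCardinalPresentable (F.obj (p.diag.obj c)) μ)
  (hp : HasSequentialCocones p.diag) [PreservesColimitsOfShape ℕ F]

include hF

omit [PreservesColimitsOfShape ℕ F] in
-- By naturality and `hX`, the two components at `p.diag.obj c` agree after passing to `G.obj X`;
-- presentability of `F.obj (p.diag.obj c)` brings the equality down to a stage `d`.
lemma exists_comp_map_eq (hX : eqProp φ ψ X) (c : C) :
    ∃ (d : C) (t : c ⟶ d),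
      φ.app (p.diag.obj c) ≫ G.map (p.diag.map t) = ψ.app (p.diag.obj c) ≫ G.map (p.diag.map t) := by
  have := G.preservesColimitsOfShape_of_isCardinalAccessible μ C
  have := hF c
  obtain ⟨d, t, h⟩ := exists_eq_of_isColimit_family (μ := μ)
    (isColimitOfPreserves G p.isColimit) (ι := PUnit.{w + 1})
    (hasCardinalLT_of_finite PUnit.{w + 1} μ (Cardinal.IsRegular.aleph0_le Fact.out))
    (Z := fun _ => F.obj (p.diag.obj c)) (j := c)
    (fun _ => φ.app (p.diag.obj c)) (fun _ => ψ.app (p.diag.obj c)) (fun _ => by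
      refine (φ.naturality (p.ι.app c)).symm.trans (Eq.trans ?_ (ψ.naturality (p.ι.app c)))
      exact congrArg (F.map (p.ι.app c) ≫ ·) hX)
  exact ⟨d, t, h ⟨⟩⟩

include hp

/-- Iterate the passage from `c` to `d c` and take the colimit `s` of the sequence. The two
components at `s` agree on each `F.obj (p.diag.obj (A n))`, hence agree because `F` preserves this
colimit. -/
lemma exists_hom_eqProp (hX : eqProp φ ψ X) (c : C) :
    ∃ (b : C) (_ : c ⟶ b), eqProp φ ψ (p.diag.obj b) := by
  choose d t ht using exists_comp_map_eq p hF hX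
  let A (n : ℕ) : C := n.rec c fun _ a => d a
  obtain ⟨s, i, hi, hs⟩ := hp.exists_colimit F (A := A) (fun n => t (A n))
  refine ⟨s, i 0, ?_⟩
  have hnat (χ : F ⟶ G) (n : ℕ) : F.map (p.diag.map (i n)) ≫ χ.app (p.diag.obj s) =
      χ.app (p.diag.obj (A n)) ≫ G.map (p.diag.map (i n)) := χ.naturality _
  have heq (n : ℕ) : φ.app (p.diag.obj (A n)) ≫ G.map (p.diag.map (i n)) =
      ψ.app (p.diag.obj (A n)) ≫ G.map (p.diag.map (i n)) := by
    rw [← hi n, p.diag.map_comp, G.map_comp, ← Category.assoc, ht, Category.assoc]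
  refine (hs _ (fun n => F.map (p.diag.map (i n)) ≫ φ.app (p.diag.obj s)) (fun n => by
    rw [← F.map_comp_assoc, ← p.diag.map_comp, hi])).unique (fun n => rfl) (fun n => ?_)
  rw [hnat, hnat, heq]

omit hp in
-- The form required by the filteredness and finality criteria. The subcategory being full, the
-- morphisms `u i ≫ v` lie in it automatically.
lemma exists_hom_eqProp_of_family (hp : HasSequentialCocones p.diag) (hX : eqProp φ ψ X)
    ⦃ι : Type w⦄ (_ : HasCardinalLT ι μ)
    (a : ι → ((eqProp φ ψ).inverseImage p.diag).FullSubcategory) (c : C)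
    (u : ∀ i, ((eqProp φ ψ).inverseImage p.diag).ι.obj (a i) ⟶ c) :
    ∃ (b : ((eqProp φ ψ).inverseImage p.diag).FullSubcategory)
      (v : c ⟶ ((eqProp φ ψ).inverseImage p.diag).ι.obj b) (t : ∀ i, a i ⟶ b),
      ∀ i, ((eqProp φ ψ).inverseImage p.diag).ι.map (t i) = u i ≫ v := by
  obtain ⟨b, v, hb⟩ := exists_hom_eqProp p hF hp hX c
  exact ⟨⟨b, hb⟩, v, fun i => ObjectProperty.homMk (u i ≫ v), fun _ => rfl⟩

end Presentation

lemma isCardinalAccessibleCategory {μ : Cardinal.{w}} [Fact μ.IsRegular]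
    [IsCardinalAccessibleCategory K μ] (hμ : Cardinal.aleph0 < μ)
    (hK : HasDirectedColimits.{w} K) (hF : PreservesDirectedColimits.{w} F)
    (hG : PreservesDirectedColimits.{w} G)
    (h : ∀ A : K, IsCardinalPresentable A μ → IsCardinalPresentable (F.obj A) μ) :
    IsCardinalAccessibleCategory (Eqf φ ψ) μ := by
  have := hF.isCardinalAccessible μ
  have := hG.isCardinalAccessible μ
  have := hF.preservesColimitsOfShape_nat
  let Q := (isCardinalPresentable K μ).inverseImage (eqProp φ ψ).ι
  have : ObjectProperty.EssentiallySmall.{w} Q := essentiallySmall_inverseImage_ι φ ψ _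
  have hQ : Q.IsCardinalFilteredGenerator μ :=
    { le_isCardinalPresentable := fun A (hA : IsCardinalPresentable A.obj μ) =>
        isCardinalPresentable_of_obj φ ψ A
      exists_colimitsOfShape := fun A => by
        obtain ⟨C, _, _, p, hp⟩ := exists_presentation_hasSequentialCocones μ hK hμ A.obj
        have hF' (c : C) := h _ (p.prop_diag_obj c)
        have hf := exists_hom_eqProp_of_family p.toColimitPresentation hF' hp A.property
        have := isCardinalFiltered_of_exists _ μ hf
        have := final_of_exists _ μ hf
        let D : ((eqProp φ ψ).inverseImage p.diag).FullSubcategory ⥤ Eqf φ ψ :=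
          ObjectProperty.lift _ (ObjectProperty.ι _ ⋙ p.diag) (fun c => c.property)
        let c : Cocone D :=
          { pt := A
            ι :=
              { app c := ObjectProperty.homMk (p.ι.app c.obj)
                naturality _ _ t := ObjectProperty.hom_ext _ (p.ι.naturality t.hom) } }
        have hc : IsColimit c := isColimitOfReflects (eqProp φ ψ).ι
          ((Functor.Final.isColimitWhiskerEquiv ((eqProp φ ψ).inverseImage p.diag).ι
            p.cocone).symm p.isColimit)
        exact ⟨_, inferInstance, inferInstance,
          ⟨{ diag := D
             ι := c.ι
             isColimit := hc
             prop_diag_obj := fun a => p.prop_diag_obj a.obj }⟩⟩ }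
  have := hQ.hasCardinalFilteredGenerator
  have : HasCardinalFilteredColimits (Eqf φ ψ) μ := ⟨fun J _ _ =>
    haveI := HasCardinalFilteredColimits.hasColimitsOfShape K μ J
    haveI := F.preservesColimitsOfShape_of_isCardinalAccessible μ J
    haveI := isClosedUnderColimitsOfShape φ ψ J
    inferInstance⟩
  constructor

lemma isAccessibleCategory [IsAccessibleCategory.{w} K] [IsAccessibleCategory.{w} L]
    (hK : HasDirectedColimits.{w} K) (hF : PreservesDirectedColimits.{w} F)
    (hG : PreservesDirectedColimits.{w} G) : IsAccessibleCategory.{w} (Eqf φ ψ) := by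
  obtain ⟨μ, _, hμ, _, h⟩ := hF.exists_cardinal hK
  exact ⟨μ, inferInstance, isCardinalAccessibleCategory hμ hK hF hG h⟩

lemma hasDirectedColimits (hK : HasDirectedColimits.{w} K) (hF : PreservesDirectedColimits.{w} F) :
    HasDirectedColimits.{w} (Eqf φ ψ) := fun J _ _ _ =>
  haveI := hK J
  haveI := hF J
  haveI := isClosedUnderColimitsOfShape φ ψ J
  inferInstance

lemma preservesDirectedColimits_ι (hK : HasDirectedColimits.{w} K)
    (hF : PreservesDirectedColimits.{w} F) :
    PreservesDirectedColimits.{w} (eqProp φ ψ).ι := fun J _ _ _ =>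
  haveI := hK J
  haveI := hF J
  haveI := isClosedUnderColimitsOfShape φ ψ J
  inferInstance

lemma preservesColimitsOfShape_of_comp_ι {J : Type u₃} [Category.{v₃} J] {X : Type*}
    [Category* X] {H : X ⥤ Eqf φ ψ} [PreservesColimitsOfShape J (H ⋙ (eqProp φ ψ).ι)] :
    PreservesColimitsOfShape J H :=
  preservesColimitsOfShape_of_reflects_of_preserves H (eqProp φ ψ).ι

lemma preservesDirectedColimits_of_comp_ι {X : Type*}
    [Category* X] {H : X ⥤ Eqf φ ψ} (hH : PreservesDirectedColimits.{w} (H ⋙ (eqProp φ ψ).ι)) :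
    PreservesDirectedColimits.{w} H := fun J _ _ _ =>
  haveI := hH J
  preservesColimitsOfShape_of_comp_ι

lemma isAccessible_of_comp_ι {X : Type*}
    [Category* X] {H : X ⥤ Eqf φ ψ} (hH : (H ⋙ (eqProp φ ψ).ι).IsAccessible.{w}) :
    H.IsAccessible.{w} := by
  obtain ⟨κ, _, _⟩ := hH.exists_cardinal
  exact ⟨κ, inferInstance, ⟨fun J _ _ =>
    haveI := (H ⋙ (eqProp φ ψ).ι).preservesColimitsOfShape_of_isCardinalAccessible κ J
    preservesColimitsOfShape_of_comp_ι⟩⟩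

end Eqf

/-! ### Universal properties of products, inserters and equifiers -/

lemma isEquivalence_of_comp_eq_id {A : Type u₁} [Category.{v₁} A] {B : Type u₂} [Category.{v₂} B]
    {T : A ⥤ B} {S : B ⥤ A} (h : T ⋙ S = 𝟭 A) (h' : S ⋙ T = 𝟭 B) : T.IsEquivalence :=
  (CategoryTheory.Equivalence.mk T S (eqToIso h.symm) (eqToIso h')).isEquivalence_functor

namespace SubTwoCat

variable {𝒮 𝒯 : SubTwoCat.{w}}

section Products

variable {I : Type w} {K : I → Type (w + 1)} [∀ i, Category.{w} (K i)]

lemma isProduct_pi (h : 𝒯.Obj (∀ i, K i)) (hP : ∀ i, 𝒯.Mor (Pi.eval K i))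
    (hlift : ∀ (X : Type (w + 1)) [Category.{w} X] (H : X ⥤ ∀ i, K i),
      (∀ i, 𝒯.Mor (H ⋙ Pi.eval K i)) → 𝒯.Mor H) :
    𝒯.IsProduct K (∀ i, K i) (Pi.eval K) where
  obj := h
  mor := hP
  universal X _ _ :=
    { full := ⟨fun {H H'} f => ⟨ObjectProperty.homMk
        { app := fun A i => (f i).hom.app A
          naturality := fun _ _ t => funext fun i => (f i).hom.naturality t }, rfl⟩⟩
      faithful := ⟨fun {H H' f g} hfg => by
        apply ObjectProperty.hom_ext
        ext A i
        exact congrArg (fun τ => τ.hom.app A) (congrFun hfg i)⟩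
      bijective_obj := by
        refine ⟨fun H H' hH => ?_, fun T => ?_⟩
        · exact ObjectProperty.FullSubcategory.ext (congrArg
            (fun T : ∀ i, 𝒯.HomCat X (K i) => Functor.pi' fun i => (T i).obj) hH)
        · exact ⟨⟨Functor.pi' fun i => (T i).obj, hlift X _ fun i => (T i).property⟩, rfl⟩ }

variable {E : Type (w + 1)} [Category.{w} E] {P : ∀ i, E ⥤ K i}
  {X : Type (w + 1)} [Category.{w} X]

lemma IsProduct.exists_lift (h : 𝒯.IsProduct K E P) (hX : 𝒯.Obj X) (T : ∀ i, X ⥤ K i)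
    (hT : ∀ i, 𝒯.Mor (T i)) : ∃ H : X ⥤ E, 𝒯.Mor H ∧ ∀ i, H ⋙ P i = T i := by
  obtain ⟨H, hH⟩ := (h.universal X hX).bijective_obj.2 fun i => ⟨T i, hT i⟩
  exact ⟨H.obj, H.property, fun i => congrArg (fun A => A.obj) (congrFun hH i)⟩

lemma IsProduct.hom_ext (h : 𝒯.IsProduct K E P) (hX : 𝒯.Obj X) {H H' : X ⥤ E} (hH : 𝒯.Mor H)
    (hH' : 𝒯.Mor H') (e : ∀ i, H ⋙ P i = H' ⋙ P i) : H = H' :=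
  congrArg (fun A => A.obj) ((h.universal X hX).bijective_obj.1
    (a₁ := ⟨H, hH⟩) (a₂ := ⟨H', hH'⟩)
    (funext fun i => ObjectProperty.FullSubcategory.ext (e i)))

/-- The usual uniqueness argument; strictness makes both composites equal to identity functors and
lets `T` commute with the projections on the nose. -/
lemma IsProduct.exists_isEquivalence (h : 𝒯.IsProduct K E P) {E' : Type (w + 1)}
    [Category.{w} E'] {P' : ∀ i, E' ⥤ K i} (h' : 𝒯.IsProduct K E' P') :
    ∃ T : E ⥤ E', T.IsEquivalence ∧ ∀ i, T ⋙ P' i = P i := by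
  obtain ⟨T, hT, eT⟩ := h'.exists_lift h.obj P h.mor
  obtain ⟨S, hS, eS⟩ := h.exists_lift h'.obj P' h'.mor
  exact ⟨T, isEquivalence_of_comp_eq_id
    (h.hom_ext h.obj (𝒯.comp_mem hT hS) (𝒯.id_mem E) fun i =>
      (congrArg (T ⋙ ·) (eS i)).trans (eT i))
    (h'.hom_ext h'.obj (𝒯.comp_mem hS hT) (𝒯.id_mem E') fun i =>
      (congrArg (S ⋙ ·) (eT i)).trans (eS i)), eT⟩

/-- Both sub-2-categories use all natural transformations, so full faithfulness only has to be
repackaged. On objects, the lift is taken in `𝒯`, and `hlift` places it in `𝒮`. -/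
lemma IsProduct.restrict (h : 𝒯.IsProduct K E P) (hc : 𝒮.IsContainedIn 𝒯)
    (hK : ∀ i, 𝒮.Obj (K i)) (hE : 𝒮.Obj E) (hP : ∀ i, 𝒮.Mor (P i))
    (hlift : ∀ (X : Type (w + 1)) [Category.{w} X] (H : X ⥤ E),
      (∀ i, 𝒮.Mor (H ⋙ P i)) → 𝒮.Mor H) :
    𝒮.IsProduct K E P where
  obj := hE
  mor := hP
  universal X _ hX := by
    have hX' := hc.obj X hX
    have hu := h.universal X hX'
    have hm (H : 𝒮.HomCat X E) : 𝒯.Mor H.obj := hc.mor _ hX hE H.property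
    refine ⟨⟨fun {H H'} f => ?_⟩, ⟨fun {H H' f g} hfg => ?_⟩, fun H H' hH => ?_, fun T => ?_⟩
    · obtain ⟨g, hg⟩ := hu.full.map_surjective (X := ⟨H.obj, hm H⟩) (Y := ⟨H'.obj, hm H'⟩)
        (fun i => ObjectProperty.homMk (f i).hom)
      exact ⟨ObjectProperty.homMk g.hom, funext fun i => ObjectProperty.hom_ext _
        (congrArg (fun τ => τ.hom) (congrFun hg i))⟩
    · refine ObjectProperty.hom_ext _ (congrArg (fun τ => τ.hom)
        (hu.faithful.map_injective (X := ⟨H.obj, hm H⟩) (Y := ⟨H'.obj, hm H'⟩)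
          (a₁ := ObjectProperty.homMk f.hom) (a₂ := ObjectProperty.homMk g.hom) ?_))
      exact funext fun i => ObjectProperty.hom_ext _ (congrArg (fun τ => τ.hom) (congrFun hfg i))
    · exact ObjectProperty.FullSubcategory.ext (h.hom_ext hX' (hm H) (hm H') fun i =>
        congrArg (fun A => A.obj) (congrFun hH i))
    · obtain ⟨H, -, eH⟩ := h.exists_lift hX' (fun i => (T i).obj)
        (fun i => hc.mor _ hX (hK i) (T i).property)
      exact ⟨⟨H, hlift X H fun i => (eH i).symm ▸ (T i).property⟩,
        funext fun i => ObjectProperty.FullSubcategory.ext (eH i)⟩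

end Products

section Inserters

variable {K L : Type (w + 1)} [Category.{w} K] [Category.{w} L] {F G : K ⥤ L}

/-- The pair `(H ⋙ P, H ◁ φ)` as an object of an inserter category of functor categories. -/
abbrev inserterData {X E : Type (w + 1)} [Category.{w} X] [Category.{w} E] {P : E ⥤ K}
    (φ : P ⋙ F ⟶ P ⋙ G) (H : X ⥤ E) :
    Ins ((Functor.whiskeringRight X K L).obj F) ((Functor.whiskeringRight X K L).obj G) where
  pt := H ⋙ P
  str := Functor.whiskerLeft H φ

/-- Precomposition of an object of an inserter category of functor categories. -/
abbrev inserterPrecomp {X Y : Type (w + 1)} [Category.{w} X] [Category.{w} Y] (T : Y ⥤ X)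
    (A : Ins ((Functor.whiskeringRight X K L).obj F) ((Functor.whiskeringRight X K L).obj G)) :
    Ins ((Functor.whiskeringRight Y K L).obj F) ((Functor.whiskeringRight Y K L).obj G) where
  pt := T ⋙ A.pt
  str := Functor.whiskerLeft T A.str

section

variable {X : Type (w + 1)} [Category.{w} X]

/-- Forgetting that functors are morphisms of `𝒯`, on objects of inserter categories. -/
abbrev inserterForget (hF : 𝒯.Mor F) (hG : 𝒯.Mor G)
    (A : Ins (𝒯.postcomp X hF) (𝒯.postcomp X hG)) :
    Ins ((Functor.whiskeringRight X K L).obj F) ((Functor.whiskeringRight X K L).obj G) where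
  pt := A.pt.obj
  str := A.str.hom

/-- Equalities of inserter data can thus be checked in plain functor categories, which serve `𝒮` and
`𝒯` alike. -/
lemma inserterForget_injective (hF : 𝒯.Mor F) (hG : 𝒯.Mor G) :
    Function.Injective (inserterForget (X := X) hF hG) := by
  rintro ⟨⟨A, hA⟩, ⟨a⟩⟩ ⟨⟨B, hB⟩, ⟨b⟩⟩ h
  obtain rfl : A = B := congrArg Ins.pt h
  obtain rfl : a = b := eq_of_heq (Ins.mk.inj h).2
  rfl

end

lemma isInserter_ins (hF : 𝒯.Mor F) (hG : 𝒯.Mor G) (h : 𝒯.Obj (Ins F G))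
    (hP : 𝒯.Mor (Ins.proj F G))
    (hlift : ∀ (X : Type (w + 1)) [Category.{w} X] (H : X ⥤ Ins F G),
      𝒯.Mor (H ⋙ Ins.proj F G) → 𝒯.Mor H) :
    𝒯.IsInserter hF hG (Ins F G) (Ins.proj F G) (Ins.nat F G) where
  obj := h
  mor := hP
  universal X _ _ := by
    let lift (A : Ins (𝒯.postcomp X hF) (𝒯.postcomp X hG)) : X ⥤ Ins F G :=
      { obj x := { pt := A.pt.obj.obj x, str := A.str.hom.app x }
        map t := { hom := A.pt.obj.map t, w := A.str.hom.naturality t }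
        map_id x := Ins.Hom.ext (A.pt.obj.map_id x)
        map_comp s t := Ins.Hom.ext (A.pt.obj.map_comp s t) }
    refine ⟨⟨fun {H H'} f => ?_⟩, ⟨fun {H H' f g} hfg => ?_⟩, fun H H' hH => ?_, fun A => ?_⟩
    · exact ⟨ObjectProperty.homMk
        { app x :=
            { hom := f.hom.hom.app x
              w := congrArg (fun τ => τ.hom.app x) f.w }
          naturality _ _ t := Ins.Hom.ext (f.hom.hom.naturality t) }, rfl⟩
    · apply ObjectProperty.hom_ext
      ext x
      exact Ins.Hom.ext (congrArg (fun τ => τ.hom.hom.app x) hfg)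
    · exact ObjectProperty.FullSubcategory.ext (congrArg lift hH)
    · exact ⟨⟨lift A, hlift X _ A.pt.property⟩, rfl⟩

variable {hF : 𝒯.Mor F} {hG : 𝒯.Mor G} {E : Type (w + 1)} [Category.{w} E] {P : E ⥤ K}
  {φ : P ⋙ F ⟶ P ⋙ G} {X : Type (w + 1)} [Category.{w} X]

lemma IsInserter.exists_lift (h : 𝒯.IsInserter hF hG E P φ) (hX : 𝒯.Obj X)
    (A : Ins ((Functor.whiskeringRight X K L).obj F) ((Functor.whiskeringRight X K L).obj G))
    (hA : 𝒯.Mor A.pt) : ∃ H : X ⥤ E, 𝒯.Mor H ∧ inserterData φ H = A := by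
  obtain ⟨H, hH⟩ := (h.universal X hX).bijective_obj.2
    { pt := ⟨A.pt, hA⟩, str := ObjectProperty.homMk A.str }
  exact ⟨H.obj, H.property, congrArg (inserterForget hF hG) hH⟩

lemma IsInserter.hom_ext (h : 𝒯.IsInserter hF hG E P φ) (hX : 𝒯.Obj X) {H H' : X ⥤ E}
    (hH : 𝒯.Mor H) (hH' : 𝒯.Mor H') (e : inserterData φ H = inserterData φ H') : H = H' :=
  congrArg (fun A => A.obj) ((h.universal X hX).bijective_obj.1
    (a₁ := ⟨H, hH⟩) (a₂ := ⟨H', hH'⟩) (inserterForget_injective hF hG e))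

lemma IsInserter.exists_isEquivalence (h : 𝒯.IsInserter hF hG E P φ) {E' : Type (w + 1)}
    [Category.{w} E'] {P' : E' ⥤ K} {φ' : P' ⋙ F ⟶ P' ⋙ G}
    (h' : 𝒯.IsInserter hF hG E' P' φ') :
    ∃ T : E ⥤ E', T.IsEquivalence ∧ T ⋙ P' = P := by
  -- The identity functor is used to regard `P` and `φ` themselves as an object of the inserter of
  -- functor categories.
  obtain ⟨T, hT, eT⟩ := h'.exists_lift h.obj (inserterData φ (𝟭 E)) h.mor
  obtain ⟨S, hS, eS⟩ := h.exists_lift h'.obj (inserterData φ' (𝟭 E')) h'.mor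
  exact ⟨T, isEquivalence_of_comp_eq_id
    (h.hom_ext h.obj (𝒯.comp_mem hT hS) (𝒯.id_mem E)
      ((congrArg (inserterPrecomp T) eS).trans eT))
    (h'.hom_ext h'.obj (𝒯.comp_mem hS hT) (𝒯.id_mem E')
      ((congrArg (inserterPrecomp S) eT).trans eS)), congrArg Ins.pt eT⟩

lemma IsInserter.restrict (h : 𝒯.IsInserter hF hG E P φ) (hc : 𝒮.IsContainedIn 𝒯)
    (hK : 𝒮.Obj K) (hF' : 𝒮.Mor F) (hG' : 𝒮.Mor G) (hE : 𝒮.Obj E) (hP : 𝒮.Mor P)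
    (hlift : ∀ (X : Type (w + 1)) [Category.{w} X] (H : X ⥤ E),
      𝒮.Mor (H ⋙ P) → 𝒮.Mor H) :
    𝒮.IsInserter hF' hG' E P φ where
  obj := hE
  mor := hP
  universal X _ hX := by
    have hX' := hc.obj X hX
    have hu := h.universal X hX'
    have hm (H : 𝒮.HomCat X E) : 𝒯.Mor H.obj := hc.mor _ hX hE H.property
    refine ⟨⟨fun {H H'} f => ?_⟩, ⟨fun {H H' f g} hfg => ?_⟩, fun H H' hH => ?_, fun A => ?_⟩
    · obtain ⟨g, hg⟩ := hu.full.map_surjective (X := ⟨H.obj, hm H⟩) (Y := ⟨H'.obj, hm H'⟩)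
        { hom := ObjectProperty.homMk f.hom.hom
          w := ObjectProperty.hom_ext _ (congrArg (fun τ => τ.hom) f.w) }
      exact ⟨ObjectProperty.homMk g.hom, Ins.Hom.ext (ObjectProperty.hom_ext _
        (congrArg (fun τ => τ.hom.hom) hg))⟩
    · refine ObjectProperty.hom_ext _ (congrArg (fun τ => τ.hom)
        (hu.faithful.map_injective (X := ⟨H.obj, hm H⟩) (Y := ⟨H'.obj, hm H'⟩)
          (a₁ := ObjectProperty.homMk f.hom) (a₂ := ObjectProperty.homMk g.hom) ?_))
      exact Ins.Hom.ext (ObjectProperty.hom_ext _ (congrArg (fun τ => τ.hom.hom) hfg))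
    · exact ObjectProperty.FullSubcategory.ext (h.hom_ext hX' (hm H) (hm H')
        (congrArg (inserterForget hF' hG') hH))
    · obtain ⟨H, -, eH⟩ := h.exists_lift hX' (inserterForget hF' hG' A)
        (hc.mor _ hX hK A.pt.property)
      have hH : H ⋙ P = A.pt.obj := congrArg Ins.pt eH
      exact ⟨⟨H, hlift X H (hH.symm ▸ A.pt.property)⟩, inserterForget_injective hF' hG' eH⟩

end Inserters

section Equifiers

variable {K L : Type (w + 1)} [Category.{w} K] [Category.{w} L] {F G : K ⥤ L} {φ ψ : F ⟶ G}

lemma isEquifier_eqf (hF : 𝒯.Mor F) (hG : 𝒯.Mor G) (h : 𝒯.Obj (Eqf φ ψ))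
    (hP : 𝒯.Mor (eqProp φ ψ).ι)
    (hlift : ∀ (X : Type (w + 1)) [Category.{w} X] (H : X ⥤ Eqf φ ψ),
      𝒯.Mor (H ⋙ (eqProp φ ψ).ι) → 𝒯.Mor H) :
    𝒯.IsEquifier hF hG φ ψ (Eqf φ ψ) (eqProp φ ψ).ι where
  obj := h
  mor := hP
  eq := by
    ext A
    exact A.property
  universal X _ _ := by
    have hA (A : Eqf (𝒯.postcompNat X hF hG φ) (𝒯.postcompNat X hF hG ψ)) (x : X) :
        eqProp φ ψ (A.obj.obj.obj x) :=
      congrArg (fun τ : (𝒯.postcomp X hF).obj A.obj ⟶ (𝒯.postcomp X hG).obj A.obj => τ.hom.app x)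
        A.property
    let lift (A : Eqf (𝒯.postcompNat X hF hG φ) (𝒯.postcompNat X hF hG ψ)) : X ⥤ Eqf φ ψ :=
      ObjectProperty.lift _ A.obj.obj (hA A)
    refine ⟨⟨fun {H H'} f => ?_⟩, ⟨fun {H H' f g} hfg => ?_⟩, fun H H' hH => ?_, fun A => ?_⟩
    · exact ⟨ObjectProperty.homMk
        { app x := ObjectProperty.homMk (f.hom.hom.app x)
          naturality _ _ t := ObjectProperty.hom_ext _ (f.hom.hom.naturality t) }, rfl⟩
    · apply ObjectProperty.hom_ext
      ext x
      exact congrArg (fun τ => τ.hom.hom.app x) hfg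
    · exact ObjectProperty.FullSubcategory.ext (congrArg lift hH)
    · exact ⟨⟨lift A, hlift X _ A.obj.property⟩, rfl⟩

variable {hF : 𝒯.Mor F} {hG : 𝒯.Mor G} {E : Type (w + 1)} [Category.{w} E] {P : E ⥤ K}
  {X : Type (w + 1)} [Category.{w} X]

lemma IsEquifier.exists_lift (h : 𝒯.IsEquifier hF hG φ ψ E P) (hX : 𝒯.Obj X) (T : X ⥤ K)
    (hT : 𝒯.Mor T) (e : Functor.whiskerLeft T φ = Functor.whiskerLeft T ψ) :
    ∃ H : X ⥤ E, 𝒯.Mor H ∧ H ⋙ P = T := by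
  obtain ⟨H, hH⟩ := (h.universal X hX).bijective_obj.2
    ⟨⟨T, hT⟩, ObjectProperty.hom_ext _ e⟩
  exact ⟨H.obj, H.property, congrArg (fun A => A.obj.obj) hH⟩

lemma IsEquifier.hom_ext (h : 𝒯.IsEquifier hF hG φ ψ E P) (hX : 𝒯.Obj X) {H H' : X ⥤ E}
    (hH : 𝒯.Mor H) (hH' : 𝒯.Mor H') (e : H ⋙ P = H' ⋙ P) : H = H' :=
  congrArg (fun A => A.obj) ((h.universal X hX).bijective_obj.1
    (a₁ := ⟨H, hH⟩) (a₂ := ⟨H', hH'⟩)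
    (ObjectProperty.FullSubcategory.ext (ObjectProperty.FullSubcategory.ext e)))

lemma IsEquifier.exists_isEquivalence (h : 𝒯.IsEquifier hF hG φ ψ E P) {E' : Type (w + 1)}
    [Category.{w} E'] {P' : E' ⥤ K} (h' : 𝒯.IsEquifier hF hG φ ψ E' P') :
    ∃ T : E ⥤ E', T.IsEquivalence ∧ T ⋙ P' = P := by
  obtain ⟨T, hT, eT⟩ := h'.exists_lift h.obj P h.mor h.eq
  obtain ⟨S, hS, eS⟩ := h.exists_lift h'.obj P' h'.mor h'.eq
  exact ⟨T, isEquivalence_of_comp_eq_id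
    (h.hom_ext h.obj (𝒯.comp_mem hT hS) (𝒯.id_mem E) ((congrArg (T ⋙ ·) eS).trans eT))
    (h'.hom_ext h'.obj (𝒯.comp_mem hS hT) (𝒯.id_mem E')
      ((congrArg (S ⋙ ·) eT).trans eS)), eT⟩

lemma IsEquifier.restrict (h : 𝒯.IsEquifier hF hG φ ψ E P) (hc : 𝒮.IsContainedIn 𝒯)
    (hK : 𝒮.Obj K) (hF' : 𝒮.Mor F) (hG' : 𝒮.Mor G) (hE : 𝒮.Obj E) (hP : 𝒮.Mor P)
    (hlift : ∀ (X : Type (w + 1)) [Category.{w} X] (H : X ⥤ E),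
      𝒮.Mor (H ⋙ P) → 𝒮.Mor H) :
    𝒮.IsEquifier hF' hG' φ ψ E P where
  obj := hE
  mor := hP
  eq := h.eq
  universal X _ hX := by
    have hX' := hc.obj X hX
    have hu := h.universal X hX'
    have hm (H : 𝒮.HomCat X E) : 𝒯.Mor H.obj := hc.mor _ hX hE H.property
    refine ⟨⟨fun {H H'} f => ?_⟩, ⟨fun {H H' f g} hfg => ?_⟩, fun H H' hH => ?_, fun A => ?_⟩
    · obtain ⟨g, hg⟩ := hu.full.map_surjective (X := ⟨H.obj, hm H⟩) (Y := ⟨H'.obj, hm H'⟩)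
        (ObjectProperty.homMk (ObjectProperty.homMk f.hom.hom))
      exact ⟨ObjectProperty.homMk g.hom, ObjectProperty.hom_ext _ (ObjectProperty.hom_ext _
        (congrArg (fun τ => τ.hom.hom) hg))⟩
    · refine ObjectProperty.hom_ext _ (congrArg (fun τ => τ.hom)
        (hu.faithful.map_injective (X := ⟨H.obj, hm H⟩) (Y := ⟨H'.obj, hm H'⟩)
          (a₁ := ObjectProperty.homMk f.hom) (a₂ := ObjectProperty.homMk g.hom) ?_))
      exact ObjectProperty.hom_ext _ (ObjectProperty.hom_ext _
        (congrArg (fun τ => τ.hom.hom) hfg))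
    · exact ObjectProperty.FullSubcategory.ext (h.hom_ext hX' (hm H) (hm H')
        (congrArg (fun A => A.obj.obj) hH))
    · obtain ⟨H, -, eH⟩ := h.exists_lift hX' A.obj.obj (hc.mor _ hX hK A.obj.property)
        (congrArg (fun τ => τ.hom) A.property)
      exact ⟨⟨H, hlift X H (eH.symm ▸ A.obj.property)⟩,
        ObjectProperty.FullSubcategory.ext (ObjectProperty.FullSubcategory.ext eH)⟩

end Equifiers

end SubTwoCat

/-! ### Closure of `AccOne` under PIE-limits -/

lemma PreservesDirectedColimits.comp {C : Type u₁} [Category.{v₁} C] {D : Type u₂}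
    [Category.{v₂} D] {E : Type u₃} [Category.{v₃} E] {F : C ⥤ D} {G : D ⥤ E}
    (hF : PreservesDirectedColimits.{w} F) (hG : PreservesDirectedColimits.{w} G) :
    PreservesDirectedColimits.{w} (F ⋙ G) := fun J _ _ _ =>
  haveI := hF J
  haveI := hG J
  inferInstance

lemma PreservesDirectedColimits.of_comp_isEquivalence {C : Type u₁} [Category.{v₁} C]
    {D : Type u₂} [Category.{v₂} D] {E : Type u₃} [Category.{v₃} E] {F : C ⥤ D} (T : D ⥤ E)
    [T.IsEquivalence] (h : PreservesDirectedColimits.{w} (F ⋙ T)) :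
    PreservesDirectedColimits.{w} F := fun J _ _ _ =>
  haveI := h J
  preservesColimitsOfShape_of_reflects_of_preserves F T

lemma IsAccessibleWithConcreteDirectedColimits.accOne {K : Type (w + 1)} [Category.{w} K]
    {U : K ⥤ Type w} (h : IsAccessibleWithConcreteDirectedColimits K U) : AccOne.{w}.Obj K :=
  ⟨⟨h.accessible, h.hasDirectedColimits⟩, U, h⟩

lemma accOne_isContainedIn_acc : AccOne.{w}.IsContainedIn Acc.{w} where
  obj _ _ h := h.1.1
  mor _ _ _ h := PreservesDirectedColimits.isAccessible h

lemma isAccessibleWithConcreteDirectedColimits_pi {I : Type w} {K : I → Type (w + 1)}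
    [∀ i, Category.{w} (K i)] {U : ∀ i, K i ⥤ Type w}
    (h : ∀ i, IsAccessibleWithConcreteDirectedColimits (K i) (U i)) :
    IsAccessibleWithConcreteDirectedColimits (∀ i, K i) (disjointUnion U) where
  accessible :=
    haveI := fun i => (h i).accessible
    isAccessibleCategory_pi fun i => (h i).hasDirectedColimits
  hasDirectedColimits := hasDirectedColimits_pi fun i => (h i).hasDirectedColimits
  faithful := faithful_disjointUnion U fun i => (h i).faithful
  preserves := preservesDirectedColimits_disjointUnion U (fun i => (h i).hasDirectedColimits)
    fun i => (h i).preserves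

section

variable {K L : Type (w + 1)} [Category.{w} K] [Category.{w} L]

/-- Accessibility of `K` is assumed and not transported: in the application `K` is a limit in `Acc`,
hence accessible by definition. -/
lemma IsAccessibleWithConcreteDirectedColimits.of_isEquivalence {U : L ⥤ Type w}
    (h : IsAccessibleWithConcreteDirectedColimits L U) (hK : IsAccessibleCategory.{w} K)
    (T : K ⥤ L) [T.IsEquivalence] : IsAccessibleWithConcreteDirectedColimits K (T ⋙ U) where
  accessible := hK
  hasDirectedColimits := h.hasDirectedColimits.of_equivalence T.asEquivalence.symm
  faithful :=
    haveI := h.faithful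
    inferInstance
  preserves := (preservesDirectedColimits_of_isEquivalence T).comp h.preserves

lemma accOne_obj_of_isEquivalence (hL : AccOne.{w}.Obj L) (hK : Acc.{w}.Obj K) (T : K ⥤ L)
    [T.IsEquivalence] : AccOne.{w}.Obj K := by
  obtain ⟨U, hU⟩ := hL.2
  exact (hU.of_isEquivalence hK T).accOne

variable {F G : K ⥤ L}

lemma accOne_obj_ins (hK : AccOne.{w}.Obj K) (hL : AccOne.{w}.Obj L)
    (hF : PreservesDirectedColimits.{w} F) (hG : PreservesDirectedColimits.{w} G) :
    AccOne.{w}.Obj (Ins F G) := by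
  obtain ⟨U, hU⟩ := hK.2
  have := hU.accessible
  have := hU.faithful
  have : IsAccessibleCategory.{w} L := hL.1.1
  exact IsAccessibleWithConcreteDirectedColimits.accOne (U := Ins.proj F G ⋙ U)
    { accessible := Ins.isAccessibleCategory hU.hasDirectedColimits hF hG
      hasDirectedColimits := Ins.hasDirectedColimits hU.hasDirectedColimits hF
      faithful := inferInstance
      preserves := (Ins.preservesDirectedColimits_proj hU.hasDirectedColimits hF).comp
        hU.preserves }

lemma accOne_obj_eqf (hK : AccOne.{w}.Obj K) (hL : AccOne.{w}.Obj L)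
    (hF : PreservesDirectedColimits.{w} F) (hG : PreservesDirectedColimits.{w} G)
    (φ ψ : F ⟶ G) : AccOne.{w}.Obj (Eqf φ ψ) := by
  obtain ⟨U, hU⟩ := hK.2
  have := hU.accessible
  have := hU.faithful
  have : IsAccessibleCategory.{w} L := hL.1.1
  exact IsAccessibleWithConcreteDirectedColimits.accOne (U := (eqProp φ ψ).ι ⋙ U)
    { accessible := Eqf.isAccessibleCategory hU.hasDirectedColimits hF hG
      hasDirectedColimits := Eqf.hasDirectedColimits hU.hasDirectedColimits hF
      faithful := inferInstance
      preserves := (Eqf.preservesDirectedColimits_ι hU.hasDirectedColimits hF).comp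
        hU.preserves }

end

lemma accOne_closedUnderProductsIn_acc : AccOne.{w}.ClosedUnderProductsIn Acc.{w} := by
  intro I K _ hK
  choose U hU using fun i => (hK i).2
  have hKd (i : I) := (hU i).hasDirectedColimits
  have hpi : AccOne.{w}.Obj (∀ i, K i) := (isAccessibleWithConcreteDirectedColimits_pi hU).accOne
  have hP (i : I) := preservesDirectedColimits_eval hKd i
  have hprod : Acc.{w}.IsProduct K (∀ i, K i) (Pi.eval K) :=
    SubTwoCat.isProduct_pi hpi.1.1 (fun i => (hP i).isAccessible) fun X _ H hH =>
      haveI : ∀ i, (H ⋙ Pi.eval K i).IsAccessible.{w} := hH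
      isAccessible_of_comp_eval H
  refine ⟨hprod, fun E _ P hE => ?_⟩
  obtain ⟨T, _, hT⟩ := hE.exists_isEquivalence hprod
  -- The given projections are replaced by those of the canonical product, precomposed with `T`.
  obtain rfl : (fun i => T ⋙ Pi.eval K i) = P := funext hT
  exact hE.restrict accOne_isContainedIn_acc hK (accOne_obj_of_isEquivalence hpi hE.obj T)
    (fun i => (preservesDirectedColimits_of_isEquivalence T).comp (hP i))
    fun X _ H hH => PreservesDirectedColimits.of_comp_isEquivalence T
      (preservesDirectedColimits_of_comp_eval (H ⋙ T) hH)

lemma accOne_closedUnderInsertersIn_acc : AccOne.{w}.ClosedUnderInsertersIn Acc.{w} := by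
  intro K L _ _ F G hK hL hF hG
  have hF' : PreservesDirectedColimits.{w} F := hF
  have hins : AccOne.{w}.Obj (Ins F G) := accOne_obj_ins hK hL hF hG
  have hP : PreservesDirectedColimits.{w} (Ins.proj F G) :=
    Ins.preservesDirectedColimits_proj hK.1.2 hF
  have hc := SubTwoCat.isInserter_ins (𝒯 := Acc.{w}) (PreservesDirectedColimits.isAccessible hF)
    (PreservesDirectedColimits.isAccessible hG) hins.1.1 hP.isAccessible
    fun X _ H hH => Ins.isAccessible_of_comp_proj hF' hH
  refine ⟨_, _, hc, fun E _ P φ hE => ?_⟩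
  obtain ⟨T, _, rfl⟩ := hE.exists_isEquivalence hc
  exact hE.restrict accOne_isContainedIn_acc hK hF hG
    (accOne_obj_of_isEquivalence hins hE.obj T)
    ((preservesDirectedColimits_of_isEquivalence T).comp hP)
    -- A functor `H` into `E` is tested on `H ⋙ T`, whose target is the canonical inserter, where
    -- the projection detects preservation of directed colimits.
    fun X _ H hH => PreservesDirectedColimits.of_comp_isEquivalence T
      (Ins.preservesDirectedColimits_of_comp_proj hF' hH)

lemma accOne_closedUnderEquifiersIn_acc : AccOne.{w}.ClosedUnderEquifiersIn Acc.{w} := by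
  intro K L _ _ F G hK hL hF hG φ ψ
  have heqf : AccOne.{w}.Obj (Eqf φ ψ) := accOne_obj_eqf hK hL hF hG φ ψ
  have hP : PreservesDirectedColimits.{w} (eqProp φ ψ).ι :=
    Eqf.preservesDirectedColimits_ι hK.1.2 hF
  have hc := SubTwoCat.isEquifier_eqf (𝒯 := Acc.{w}) (φ := φ) (ψ := ψ)
    (PreservesDirectedColimits.isAccessible hF) (PreservesDirectedColimits.isAccessible hG)
    heqf.1.1 hP.isAccessible fun X _ H hH => Eqf.isAccessible_of_comp_ι hH
  refine ⟨_, _, hc, fun E _ P hE => ?_⟩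
  obtain ⟨T, _, rfl⟩ := hE.exists_isEquivalence hc
  exact hE.restrict accOne_isContainedIn_acc hK hF hG
    (accOne_obj_of_isEquivalence heqf hE.obj T)
    ((preservesDirectedColimits_of_isEquivalence T).comp hP)
    fun X _ H hH => PreservesDirectedColimits.of_comp_isEquivalence T
      (Eqf.preservesDirectedColimits_of_comp_ι hH)

end AccPIE

theorem theorem2p3 :
    AccPIE.AccOne.{w}.ClosedUnderPIELimitsIn AccPIE.Acc.{w} ∧
    ∀ (I : Type w) (K : I → Type (w + 1)) [∀ i, Category.{w} (K i)] (U : ∀ i, K i ⥤ Type w),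
      (∀ i, AccPIE.IsAccessibleWithConcreteDirectedColimits (K i) (U i)) →
      AccPIE.IsAccessibleWithConcreteDirectedColimits (∀ i, K i) (AccPIE.disjointUnion U) :=
  ⟨{ contained := AccPIE.accOne_isContainedIn_acc
     products := AccPIE.accOne_closedUnderProductsIn_acc
     inserters := AccPIE.accOne_closedUnderInsertersIn_acc
     equifiers := AccPIE.accOne_closedUnderEquifiersIn_acc },
    fun _ _ _ _ h => AccPIE.isAccessibleWithConcreteDirectedColimits_pi h⟩
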